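/- Identify $\mathbb{R}^2$ with $\mathbb{C}$, write $x=(x_1,x_2)$, $\bar x=(x_1,-x_2)$, and $\nabla^\perp f=(-\partial_2 f,\partial_1 f)$. Let either $\Omega=\mathbb{H}=\{x\in\mathbb{R}^2: x_2>0\}$ be the half-plane, or $\Omega=\mathbb{D}=\{x\in\mathbb{R}^2:|x|<1\}$ the unit disk. The Green's function of the Dirichlet Laplacian in $\Omega$ is $$G_\Omega(x,y)=\frac1{2\pi}\ln|x-y|+\gamma_\Omega(x,y),\qquad \gamma_{\mathbb H}(x,y)=-\frac1{2\pi}\ln|x-\bar y|,\qquad \gamma_{\mathbb D}(x,y)=-\frac1{2\pi}\ln|1-x\bar y|$$ (complex product in the last formula), and the Robin function is $\tilde\gamma_\Omega(x)=\gamma_\Omega(x,x)$. Let $N\in\mathbb{N}$, let $a_1,\dots,a_N>0$, and let $x_1^0,\dots,x_N^0\in\Omega$ be pairwise distinct. A solution of the point-vortex dynamics on a time interval $J\ni 0$ (where $J=[0,T)$ or $J=[0,\infty)$) is a family of curves $x_1,\dots,x_N:J\to\Omega$ with $x_i(0)=x_i^0$ that remain pairwise distinct and satisfy, for all $t\in J$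 and all $i$ (with a one-sided derivative at $t=0$), $$\frac{d}{dt}x_i(t)=\sum_{j\ne i}a_j\,\nabla_x^\perp G_\Omega(x_i(t),x_j(t))+\frac{a_i}{2}\,\nabla^\perp\tilde\gamma_\Omega(x_i(t)).$$ Then the point-vortex dynamics has a global solution, that is, a solution on $[0,\infty)$. Moreover no collapse can occur: for every $T\in(0,\infty)$ and every solution on $[0,T)$, $$\liminf_{t\to T^-}|x_i(t)-x_j(t)|>0\quad\text{for all } i\neq j,\qquad \liminf_{t\to T^-}\operatorname{dist}(x_i(t),\partial\Omega)>0\quad\text{for all } i.$$ -/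

import Mathlib

namespace PointVortex

open Complex Filter Topology
open scoped ComplexConjugate

noncomputable section

/-! The plane `ℝ²` is identified with `ℂ` (same Euclidean norm, `x = x₁ + i x₂`); the rotation
`x ↦ x^⊥ = (-x₂, x₁)` is multiplication by `i`. -/

/-- The open half-plane `{x₂ > 0}`. -/
def halfPlane : Set ℂ := {x | 0 < x.im}

/-- The open unit disk. -/
def unitDisk : Set ℂ := Metric.ball 0 1

/-- Green's function of the plane, `(2π)⁻¹ log |x - y|`. -/
def greenPlane (x y : ℂ) : ℝ := 1 / (2 * Real.pi) * Real.log ‖x - y‖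

/-- Green's function `G = G_{ℝ²} + γ` with regular part `γ`. -/
def greenFunction (γ : ℂ → ℂ → ℝ) (x y : ℂ) : ℝ := greenPlane x y + γ x y

/-- Robin's function: the diagonal values of the regular part of Green's function. -/
def robinFunction (γ : ℂ → ℂ → ℝ) (x : ℂ) : ℝ := γ x x

/-- The regular part of Green's function of the half-plane, `-(2π)⁻¹ log |x - ȳ|`. -/
def regularHalfPlane (x y : ℂ) : ℝ := -(1 / (2 * Real.pi)) * Real.log ‖x - conj y‖

/-- The regular part of Green's function of the unit disk, `-(2π)⁻¹ log |1 - x ȳ|`. For `y ≠ 0`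
this is `-(2π)⁻¹ log (|x - y*| |y|)` with `y* = y / |y|²`; at `y = 0` it is the continuous
extension of that expression. -/
def regularDisk (x y : ℂ) : ℝ := -(1 / (2 * Real.pi)) * Real.log ‖1 - x * conj y‖

/-- The perpendicular gradient `∇^⊥ f = (-∂₂ f, ∂₁ f)` of a real function on the plane. -/
def perpGrad (f : ℂ → ℝ) (x : ℂ) : ℂ := I * gradient f x

/-- The velocity of the `i`-th vortex in the configuration `x`, for a simply connected domain whose
Green's function has the regular part `γ`:
`∑_{j ≠ i} a_j ∇^⊥_x G(x_i, x_j) + (a_i / 2) ∇^⊥ γ̃(x_i)`. -/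
def velocity {N : ℕ} (γ : ℂ → ℂ → ℝ) (a : Fin N → ℝ) (x : Fin N → ℂ) (i : Fin N) : ℂ :=
  (∑ j ∈ Finset.univ.erase i, (a j : ℂ) * perpGrad (fun z => greenFunction γ z (x j)) (x i))
    + ((a i / 2 : ℝ) : ℂ) * perpGrad (robinFunction γ) (x i)

/-- `x` solves the point-vortex dynamics in `Ω` on the time set `S` (an interval that starts at `0`)
with the initial positions `x₀`. The vortices stay in `Ω` and stay pairwise distinct, so that the
right-hand side makes sense; the derivative at the initial time is one-sided. -/
structure IsSolutionOn {N : ℕ} (Ω : Set ℂ) (γ : ℂ → ℂ → ℝ) (a : Fin N → ℝ) (x₀ : Fin N → ℂ)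
    (S : Set ℝ) (x : ℝ → Fin N → ℂ) : Prop where
  initial : x 0 = x₀
  mem : ∀ t ∈ S, ∀ i, x t i ∈ Ω
  distinct : ∀ t ∈ S, ∀ i j, i ≠ j → x t i ≠ x t j
  ode : ∀ t ∈ S, ∀ i, HasDerivWithinAt (fun s => x s i) (velocity γ a (x t) i) S t

/-- The `i`-th and the `j`-th vortex collapse at time `T`:
`liminf_{t → T⁻} |x_i(t) - x_j(t)| = 0` (the liminf is taken in `[0, ∞]`). -/
def CollapseAt {N : ℕ} (x : ℝ → Fin N → ℂ) (T : ℝ) (i j : Fin N) : Prop :=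
  liminf (fun t => edist (x t i) (x t j)) (𝓝[<] T) = 0

/-- The `i`-th vortex collapses with the boundary of `Ω` at time `T`:
`liminf_{t → T⁻} dist(x_i(t), ∂Ω) = 0` (the liminf is taken in `[0, ∞]`). -/
def BoundaryCollapseAt {N : ℕ} (Ω : Set ℂ) (x : ℝ → Fin N → ℂ) (T : ℝ) (i : Fin N) : Prop :=
  liminf (fun t => Metric.infEDist (x t i) (frontier Ω)) (𝓝[<] T) = 0

/-! The formulas above do give the Green's functions of the two domains. -/

/-- `G = G_{ℝ²} + γ` is the Green's function of the Dirichlet problem in `Ω`: for every `y ∈ Ω`,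
`γ(·, y)` is harmonic in `Ω` (so that `Δ G(·, y) = δ_y`) and continuous up to the boundary,
`G(·, y)` vanishes on the boundary and, if `Ω` is unbounded, at infinity. -/
structure IsRegularPart (Ω : Set ℂ) (γ : ℂ → ℂ → ℝ) : Prop where
  harmonic : ∀ y ∈ Ω, InnerProductSpace.HarmonicOnNhd (fun x => γ x y) Ω
  continuousOn : ∀ y ∈ Ω, ContinuousOn (fun x => γ x y) (closure Ω)
  boundary : ∀ y ∈ Ω, ∀ x ∈ frontier Ω, greenFunction γ x y = 0
  infinity : ∀ y ∈ Ω, Tendsto (fun x => greenFunction γ x y) (Bornology.cobounded ℂ ⊓ 𝓟 Ω) (𝓝 0)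

/-- `regularDisk` is the regular part of the Green's function of the unit disk. -/
lemma isRegularPart_disk : IsRegularPart unitDisk regularDisk := by
  have hne : ∀ y ∈ unitDisk, ∀ x : ℂ, ‖x‖ ≤ 1 → 1 - x * conj y ≠ 0 := by
    intro y hy x hx h
    have hy' : ‖y‖ < 1 := by simpa [unitDisk] using hy
    have h1 : ‖x * conj y‖ = 1 := by
      rw [← sub_eq_zero.mp h]; simp
    rw [norm_mul, Complex.norm_conj] at h1
    nlinarith [norm_nonneg x, norm_nonneg y]
  refine ⟨?_, ?_, ?_, ?_⟩
  · intro y hy x hx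
    have hx' : ‖x‖ < 1 := by simpa [unitDisk] using hx
    have hA : AnalyticAt ℂ (fun z : ℂ => 1 - z * conj y) x := by fun_prop
    exact (hA.harmonicAt_log_norm (hne y hy x hx'.le)).const_smul
  · intro y hy x hx
    have hx' : ‖x‖ ≤ 1 := by simpa [unitDisk, closure_ball] using hx
    have h0 := hne y hy x hx'
    have : ContinuousAt (fun z : ℂ => Real.log ‖1 - z * conj y‖) x :=
      ContinuousAt.log (by fun_prop) (by simpa using h0)
    exact (continuousAt_const.mul this).continuousWithinAt
  · intro y hy x hx
    have hx' : ‖x‖ = 1 := by simpa [unitDisk, frontier_ball] using hx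
    have hxx : conj x * x = 1 := by
      rw [mul_comm, Complex.mul_conj, Complex.normSq_eq_norm_sq, hx']; simp
    have h : ‖1 - x * conj y‖ = ‖x - y‖ := by
      calc ‖1 - x * conj y‖ = ‖conj (x - y)‖ * ‖x‖ := by
            rw [← norm_mul, map_sub, sub_mul, hxx, mul_comm x]
        _ = ‖x - y‖ := by rw [hx', Complex.norm_conj, mul_one]
    simp only [greenFunction, greenPlane, regularDisk, h]
    ring
  · intro y _
    have : Bornology.cobounded ℂ ⊓ 𝓟 unitDisk = ⊥ := by
      rw [inf_principal_eq_bot]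
      exact Bornology.isBounded_def.mp Metric.isBounded_ball
    rw [this]; exact tendsto_bot

/-- `regularHalfPlane` is the regular part of the Green's function of the half-plane. -/
lemma isRegularPart_halfPlane : IsRegularPart halfPlane regularHalfPlane := by
  have hne : ∀ y ∈ halfPlane, ∀ x : ℂ, 0 ≤ x.im → x - conj y ≠ 0 := by
    intro y hy x hx h
    have hy' : 0 < y.im := hy
    have := congrArg Complex.im h
    simp at this
    linarith
  refine ⟨?_, ?_, ?_, ?_⟩
  · intro y hy x hx
    have hA : AnalyticAt ℂ (fun z : ℂ => z - conj y) x := by fun_prop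
    exact (hA.harmonicAt_log_norm (hne y hy x (le_of_lt hx))).const_smul
  · intro y hy x hx
    have hx' : 0 ≤ x.im := by
      have : x ∈ closure {z : ℂ | 0 < z.im} := hx
      rw [Complex.closure_setOfPred_lt_im] at this
      exact this
    have h0 := hne y hy x hx'
    have : ContinuousAt (fun z : ℂ => Real.log ‖z - conj y‖) x :=
      ContinuousAt.log (by fun_prop) (by simpa using h0)
    exact (continuousAt_const.mul this).continuousWithinAt
  · intro y hy x hx
    have hx' : x.im = 0 := by
      have : x ∈ frontier {z : ℂ | 0 < z.im} := hx
      rw [Complex.frontier_setOfPred_lt_im] at this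
      exact this
    have h : ‖x - conj y‖ = ‖x - y‖ := by
      have hc : conj x = x := Complex.conj_eq_iff_im.mpr hx'
      rw [← Complex.norm_conj (x - y), map_sub, hc]
    simp only [greenFunction, greenPlane, regularHalfPlane, h]
    ring
  · intro y hy
    have hT : Tendsto (fun x : ℂ => x - conj y) (Bornology.cobounded ℂ) (Bornology.cobounded ℂ) := by
      simpa only [sub_eq_add_neg] using tendsto_add_const_cobounded (-(conj y))
    have h1 : Tendsto (fun x : ℂ => 1 - (y - conj y) * (x - conj y)⁻¹) (Bornology.cobounded ℂ)
        (𝓝 1) := by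
      have := (Filter.tendsto_inv₀_cobounded.comp hT).const_mul (y - conj y)
      simpa using this.const_sub 1
    have h2 : Tendsto (fun x : ℂ => 1 / (2 * Real.pi) *
        Real.log ‖1 - (y - conj y) * (x - conj y)⁻¹‖) (Bornology.cobounded ℂ) (𝓝 0) := by
      have := (h1.norm.log (by simp)).const_mul (1 / (2 * Real.pi))
      simpa using this
    refine (h2.mono_left inf_le_left).congr' ?_
    have hb : ∀ᶠ x in Bornology.cobounded ℂ, x ≠ y := Bornology.eventually_ne_cobounded y
    filter_upwards [hb.filter_mono inf_le_left, mem_inf_of_right (mem_principal_self halfPlane)]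
      with x hxy hx
    have h0 := hne y hy x (le_of_lt hx)
    have e : 1 - (y - conj y) * (x - conj y)⁻¹ = (x - y) / (x - conj y) := by
      field_simp
      ring
    rw [e, norm_div, Real.log_div (by simpa [sub_eq_zero] using hxy) (by simpa using h0)]
    simp only [greenFunction, greenPlane, regularHalfPlane]
    ring

end

end PointVortex

/-! In both domains a height `s`, vanishing on the boundary (`2 * x.im`, respectively `1 - ‖x‖ ^
2`), turns the Green's function into `(4π)⁻¹ log (r² / (r² + s x * s y))` with `r = ‖x - y‖`, and
the Robin function into `-(2π)⁻¹ log s`. Everything rests on this common form.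

Boundary collapse is excluded first. The self-interaction moves a vortex along the level sets of
`s`, so heights change only through pair interactions `m i j`. These are antisymmetric by the
translation or rotation symmetry of the domain, and `|s i - s j| * |m i j|` is bounded even when
vortices merge or reach the boundary. Symmetrising the double sum shows that `∑ a i * φ (s i)` has
bounded derivative whenever `φ'` is Lipschitz, so it converges as `t → T` (`exists_tendsto_sum`).
Bump functions and the pigeonhole principle then give levels, arbitrarily close to zero, that no
height crosses near `T` (`exists_avoided_level`); hence each height tends to zero or stays away from
it. In the weighted sum of the heights tending to zero the internal interactions cancel, and the
interactions with the remaining vortices, which are at a definite distance, are at most proportional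
to the heights. By Gronwall this sum cannot vanish in finite time (`eventually_le`).

With the heights bounded below, the self-energies are bounded above; since every pair energy is
nonpositive, conservation of the Hamiltonian bounds each one below, which separates the vortices
(`exists_separation`). The velocity is then bounded, the trajectory stays in a compact part of phase
space, and the local solution continues for all time. -/

namespace PointVortex

open Complex Filter Topology
open scoped ComplexConjugate

/-! ### Autonomous ODEs: uniqueness, gluing and continuation -/

section Flow

variable {E : Type*} [NormedAddCommGroup E] [NormedSpace ℝ E] {U : Set E} {v : E → E}

/-- A curve that solves the autonomous equation `x' = v x` on the time set `S` inside `U`. -/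
structure IsFlowLine (U : Set E) (v : E → E) (S : Set ℝ) (x : ℝ → E) : Prop where
  mem : ∀ t ∈ S, x t ∈ U
  ode : ∀ t ∈ S, HasDerivWithinAt x (v (x t)) S t

lemma IsFlowLine.mono {S S' : Set ℝ} {x : ℝ → E} (h : IsFlowLine U v S x) (hS : S' ⊆ S) :
    IsFlowLine U v S' x :=
  ⟨fun t ht => h.mem t (hS ht), fun t ht => (h.ode t (hS ht)).mono hS⟩

lemma IsFlowLine.continuousOn {S : Set ℝ} {x : ℝ → E} (h : IsFlowLine U v S x) :
    ContinuousOn x S :=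
  fun t ht => (h.ode t ht).continuousWithinAt

/-- The field is only locally Lipschitz on `U`, but it is Lipschitz on the compact union of the two
trajectories over `[0, b]`, which suffices for Gronwall uniqueness. -/
lemma IsFlowLine.eqOn (hv : ∀ x ∈ U, ContDiffAt ℝ 1 v x) {T : ℝ} {x y : ℝ → E}
    (hx : IsFlowLine U v (Set.Ico 0 T) x) (hy : IsFlowLine U v (Set.Ico 0 T) y)
    (h0 : x 0 = y 0) : Set.EqOn x y (Set.Ico 0 T) := by
  intro b hb
  have hsub : Set.Icc 0 b ⊆ Set.Ico 0 T := fun t ht => ⟨ht.1, ht.2.trans_lt hb.2⟩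
  have hxc := hx.continuousOn.mono hsub
  have hyc := hy.continuousOn.mono hsub
  set K : Set E := x '' Set.Icc 0 b ∪ y '' Set.Icc 0 b with hK
  have hKc : IsCompact K := (isCompact_Icc.image_of_continuousOn hxc).union
    (isCompact_Icc.image_of_continuousOn hyc)
  have hKU : K ⊆ U := by
    rintro z (⟨t, ht, rfl⟩ | ⟨t, ht, rfl⟩)
    · exact hx.mem t (hsub ht)
    · exact hy.mem t (hsub ht)
  have hloc : LocallyLipschitzOn K v := by
    intro z hz
    obtain ⟨C, s, hs, hC⟩ := (hv z (hKU hz)).exists_lipschitzOnWith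
    exact ⟨C, s, mem_nhdsWithin_of_mem_nhds hs, hC⟩
  obtain ⟨C, hC⟩ := hloc.exists_lipschitzOnWith_of_compact hKc
  have hder : ∀ {z : ℝ → E}, IsFlowLine U v (Set.Ico 0 T) z → ∀ t ∈ Set.Ico 0 b,
      HasDerivWithinAt z (v (z t)) (Set.Ici t) t := by
    intro z hz t ht
    refine (hz.ode t (hsub ⟨ht.1, ht.2.le⟩)).mono_of_mem_nhdsWithin ?_
    exact mem_of_superset (Ico_mem_nhdsGE (ht.2.trans hb.2))
      (Set.Ico_subset_Ico_left ht.1)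
  exact ODE_solution_unique_of_mem_Icc_right (v := fun _ => v) (s := fun _ => K)
    (fun t _ => hC) hxc (hder hx)
    (fun t ht => Or.inl ⟨t, ⟨ht.1, ht.2.le⟩, rfl⟩) hyc (hder hy)
    (fun t ht => Or.inr ⟨t, ⟨ht.1, ht.2.le⟩, rfl⟩) h0 ⟨hb.1, le_rfl⟩

/-- Flow lines with a common starting point on intervals `[0, τ)` glue. -/
lemma exists_isFlowLine_of_forall (hv : ∀ x ∈ U, ContDiffAt ℝ 1 v x) {x₀ : E} {S : Set ℝ}
    (hS : S ⊆ Set.Ici 0) (hne : (0 : ℝ) ∈ S)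
    (h : ∀ t ∈ S, ∃ τ > t, ∃ x, x 0 = x₀ ∧ IsFlowLine U v (Set.Ico 0 τ) x) :
    ∃ x, x 0 = x₀ ∧ IsFlowLine U v S x := by
  choose! τ hτ X hX0 hX using h
  have key : ∀ t ∈ S, ∀ s ∈ S, s < τ t → X s s = X t s := by
    intro t ht s hs hst
    have hsub1 : Set.Ico 0 (min (τ s) (τ t)) ⊆ Set.Ico 0 (τ s) :=
      Set.Ico_subset_Ico_right (min_le_left _ _)
    have hsub2 : Set.Ico 0 (min (τ s) (τ t)) ⊆ Set.Ico 0 (τ t) :=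
      Set.Ico_subset_Ico_right (min_le_right _ _)
    exact IsFlowLine.eqOn hv ((hX s hs).mono hsub1) ((hX t ht).mono hsub2)
      ((hX0 s hs).trans (hX0 t ht).symm) ⟨hS hs, lt_min (hτ s hs) hst⟩
  -- The diagonal choice `X t t` coincides with the single flow line `X t` near `t`, by uniqueness,
  -- and inherits its derivative.
  refine ⟨fun t => X t t, hX0 0 hne, fun t ht => (hX t ht).mem t ⟨hS ht, hτ t ht⟩, ?_⟩
  intro t ht
  have h1 := (hX t ht).ode t ⟨hS ht, hτ t ht⟩
  have h2 : HasDerivWithinAt (X t) (v (X t t)) S t := by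
    refine h1.mono_of_mem_nhdsWithin ?_
    filter_upwards [self_mem_nhdsWithin, mem_nhdsWithin_of_mem_nhds (Iio_mem_nhds (hτ t ht))]
      with s hs hs'
    exact ⟨hS hs, hs'⟩
  refine h2.congr_of_eventuallyEq ?_ rfl
  filter_upwards [self_mem_nhdsWithin, mem_nhdsWithin_of_mem_nhds (Iio_mem_nhds (hτ t ht))]
    with s hs hs'
  exact key t ht s hs hs'

/-- The existence time `ε` is uniform over starting points near `p`: continuation needs this, since
it restarts from points that merely approach `p`. Joint continuity of the local flow keeps the short
trajectories in the open set `U`. -/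
lemma exists_isFlowLine_of_mem_closedBall [CompleteSpace E] (hU : IsOpen U)
    (hv : ∀ x ∈ U, ContDiffAt ℝ 1 v x) {p : E} (hp : p ∈ U) :
    ∃ r > (0 : ℝ), ∃ ε > (0 : ℝ), ∀ z ∈ Metric.closedBall p r,
      ∃ α, α 0 = z ∧ IsFlowLine U v (Set.Ioo (-ε) ε) α := by
  obtain ⟨δ, hδ, a, r, L, K, hr, hpl⟩ := IsPicardLindelof.of_contDiffAt_one (hv p hp)
  obtain ⟨α, hα, hαc⟩ :=
    (hpl 0).exists_forall_mem_closedBall_eq_hasDerivWithinAt_continuousOn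
  have hr' : (0 : ℝ) < r := hr
  have hp0 : α (p, 0) = p := (hα p (Metric.mem_closedBall_self hr'.le)).1
  have hnhds : Metric.closedBall p r ×ˢ Set.Icc (0 - δ) (0 + δ) ∈ 𝓝 (p, (0 : ℝ)) :=
    prod_mem_nhds (Metric.closedBall_mem_nhds p hr') (Icc_mem_nhds (by linarith) (by linarith))
  have hev : ∀ᶠ q in 𝓝 (p, (0 : ℝ)), α q ∈ U :=
    (hαc.continuousAt hnhds).eventually_mem (by rw [hp0]; exact hU.mem_nhds hp)
  rw [nhds_prod_eq] at hev
  obtain ⟨P, hP, Q, hQ, hPQ⟩ := Filter.eventually_prod_iff.mp hev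
  obtain ⟨r', hr'0, hr'P⟩ := Metric.nhds_basis_closedBall.eventually_iff.mp hP
  obtain ⟨ε, hε, hεQ⟩ := Metric.nhds_basis_ball.eventually_iff.mp hQ
  refine ⟨min r r', lt_min hr' hr'0, min δ ε, lt_min hδ hε, fun z hz => ?_⟩
  have hz1 : z ∈ Metric.closedBall p r := Metric.closedBall_subset_closedBall (min_le_left _ _) hz
  have hz2 : z ∈ Metric.closedBall p r' :=
    Metric.closedBall_subset_closedBall (min_le_right _ _) hz
  refine ⟨fun t => α (z, t), (hα z hz1).1, fun t ht => ?_, fun t ht => ?_⟩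
  · refine hPQ (hr'P hz2) (hεQ ?_)
    rw [Real.ball_eq_Ioo]
    have := min_le_right δ ε
    constructor <;> linarith [ht.1, ht.2]
  · have hsub : Set.Ioo (-min δ ε) (min δ ε) ⊆ Set.Icc (0 - δ) (0 + δ) := by
      intro s hs
      have := min_le_left δ ε
      constructor <;> linarith [hs.1, hs.2]
    exact ((hα z hz1).2 t (hsub ht)).mono hsub

lemma IsFlowLine.concat {T b ε : ℝ} {x α : ℝ → E} (hx : IsFlowLine U v (Set.Ico 0 T) x)
    (hb : b ∈ Set.Ico 0 T) (hε : 0 < ε) (hα : IsFlowLine U v (Set.Ioo (-ε) ε) α)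
    (hα0 : α 0 = x b) :
    IsFlowLine U v (Set.Ico 0 (b + ε)) (fun t => if t ≤ b then x t else α (t - b)) := by
  have hr : ∀ t, b ≤ t → (if t ≤ b then x t else α (t - b)) = α (t - b) := by
    intro t ht
    split_ifs with h
    · rw [le_antisymm h ht, sub_self, hα0]
    · rfl
  have hl : ∀ t, t ≤ b → (if t ≤ b then x t else α (t - b)) = x t := fun t ht => if_pos ht
  set y : ℝ → E := fun t => if t ≤ b then x t else α (t - b) with hy
  have hleft : ∀ t ∈ Set.Icc 0 b, HasDerivWithinAt y (v (y t)) (Set.Icc 0 b) t := by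
    intro t ht
    have h1 := (hx.ode t ⟨ht.1, ht.2.trans_lt hb.2⟩).mono
      (fun s (hs : s ∈ Set.Icc 0 b) => ⟨hs.1, hs.2.trans_lt hb.2⟩)
    have h2 : y t = x t := hl t ht.2
    rw [h2]
    exact h1.congr (fun s hs => hl s hs.2) h2
  have hright : ∀ t ∈ Set.Ico b (b + ε),
      HasDerivWithinAt y (v (y t)) (Set.Ico b (b + ε)) t := by
    intro t ht
    have h0 : t - b ∈ Set.Ioo (-ε) ε := ⟨by linarith [ht.1], by linarith [ht.2]⟩
    have h1 : HasDerivAt α (v (α (t - b))) (t - b) :=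
      (hα.ode _ h0).hasDerivAt (Ioo_mem_nhds h0.1 h0.2)
    have h2 : y t = α (t - b) := hr t ht.1
    rw [h2]
    exact (h1.comp_sub_const t b).hasDerivWithinAt.congr (fun s hs => hr s hs.1) h2
  refine ⟨fun t ht => ?_, fun t ht => ?_⟩
  · rcases le_total t b with h | h
    · rw [show y t = x t from hl t h]
      exact hx.mem t ⟨ht.1, h.trans_lt hb.2⟩
    · rw [show y t = α (t - b) from hr t h]
      exact hα.mem _ ⟨by linarith, by linarith [ht.2]⟩
  · rcases lt_trichotomy t b with h | h | h
    · refine (hleft t ⟨ht.1, h.le⟩).mono_of_mem_nhdsWithin ?_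
      filter_upwards [self_mem_nhdsWithin, mem_nhdsWithin_of_mem_nhds (Iio_mem_nhds h)]
        with s hs hs'
      exact ⟨hs.1, le_of_lt hs'⟩
    · subst h
      refine ((hleft t ⟨ht.1, le_rfl⟩).union (hright t ⟨le_rfl, ht.2⟩)).mono ?_
      intro s hs
      rcases le_total s t with h | h
      · exact Or.inl ⟨hs.1, h⟩
      · exact Or.inr ⟨h, hs.2⟩
    · refine (hright t ⟨h.le, ht.2⟩).mono_of_mem_nhdsWithin ?_
      filter_upwards [self_mem_nhdsWithin, mem_nhdsWithin_of_mem_nhds (Ioi_mem_nhds h)]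
        with s hs hs'
      exact ⟨le_of_lt hs', hs.2⟩

/-- A flow line that stays in a compact subset of the open phase space can be continued. -/
lemma IsFlowLine.exists_extension [CompleteSpace E] (hU : IsOpen U)
    (hv : ∀ x ∈ U, ContDiffAt ℝ 1 v x) {T : ℝ} (hT : 0 < T) {x : ℝ → E}
    (hx : IsFlowLine U v (Set.Ico 0 T) x) {K : Set E} (hK : IsCompact K) (hKU : K ⊆ U)
    (hxK : ∀ t ∈ Set.Ico 0 T, x t ∈ K) :
    ∃ τ > T, ∃ y, y 0 = x 0 ∧ IsFlowLine U v (Set.Ico 0 τ) y := by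
  have hmem : Set.Ico 0 T ∈ 𝓝[<] T := Ico_mem_nhdsLT hT
  -- The trajectory need not converge at `T`, but it has a cluster point `p` in `K`; restarting near
  -- `p` at a time `b > T - ε` carries it past `T`.
  obtain ⟨p, hpK, hp⟩ := hK.exists_mapClusterPt (f := 𝓝[<] T) (u := x)
    (by rw [le_principal_iff, mem_map]; exact mem_of_superset hmem fun t ht => hxK t ht)
  obtain ⟨r, hr, ε, hε, hflow⟩ := exists_isFlowLine_of_mem_closedBall hU hv (hKU hpK)
  have hfreq := hp.frequently (Metric.closedBall_mem_nhds p hr)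
  have hnear : Set.Ioo (T - ε) T ∈ 𝓝[<] T := Ioo_mem_nhdsLT (by linarith)
  obtain ⟨b, hbr, hb, hbε⟩ := (hfreq.and_eventually (inter_mem hmem hnear)).exists
  obtain ⟨α, hα0, hα⟩ := hflow (x b) hbr
  exact ⟨b + ε, by linarith [hbε.1], _, if_pos hb.1, hx.concat hb hε hα hα0⟩

/-- A flow line exists globally if every flow line on a bounded interval stays in a compact subset
of the phase space. -/
theorem exists_isFlowLine_Ici [CompleteSpace E] (hU : IsOpen U)
    (hv : ∀ x ∈ U, ContDiffAt ℝ 1 v x) {x₀ : E} (hx₀ : x₀ ∈ U)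
    (hK : ∀ T > 0, ∀ x, x 0 = x₀ → IsFlowLine U v (Set.Ico 0 T) x →
      ∃ K ⊆ U, IsCompact K ∧ ∀ t ∈ Set.Ico 0 T, x t ∈ K) :
    ∃ x, x 0 = x₀ ∧ IsFlowLine U v (Set.Ici 0) x := by
  set A : Set ℝ := {T | 0 < T ∧ ∃ x, x 0 = x₀ ∧ IsFlowLine U v (Set.Ico 0 T) x} with hA
  have hne : A.Nonempty := by
    obtain ⟨r, hr, ε, hε, hflow⟩ := exists_isFlowLine_of_mem_closedBall hU hv hx₀
    obtain ⟨α, hα0, hα⟩ := hflow x₀ (Metric.mem_closedBall_self hr.le)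
    exact ⟨ε, hε, α, hα0, hα.mono fun t ht => ⟨by linarith [ht.1], ht.2⟩⟩
  have hunb : ¬ BddAbove A := by
    intro hbdd
    have hpos : 0 < sSup A := by
      obtain ⟨T, hT⟩ := hne
      exact hT.1.trans_le (le_csSup hbdd hT)
    obtain ⟨x, hx0, hx⟩ := exists_isFlowLine_of_forall (x₀ := x₀) (S := Set.Ico 0 (sSup A)) hv
      Set.Ico_subset_Ici_self ⟨le_rfl, hpos⟩ (by
        intro t ht
        obtain ⟨T, hTA, hT⟩ := exists_lt_of_lt_csSup hne ht.2
        exact ⟨T, hT, hTA.2⟩)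
    obtain ⟨K, hKU, hKc, hxK⟩ := hK _ hpos x hx0 hx
    obtain ⟨τ, hτ, y, hy0, hy⟩ := hx.exists_extension hU hv hpos hKc hKU hxK
    exact absurd (le_csSup hbdd ⟨hpos.trans hτ, y, hy0.trans hx0, hy⟩) (not_le.mpr hτ)
  refine exists_isFlowLine_of_forall hv subset_rfl (Set.mem_Ici.mpr le_rfl) fun t _ => ?_
  obtain ⟨T, hTA, hT⟩ := not_bddAbove_iff.mp hunb t
  exact ⟨T, hT, hTA.2⟩

end Flow

/-! ### Heights driven by antisymmetric interactions stay positive -/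

section HeightSystem

variable {ι : Type*} [Fintype ι]

/-- Positive functions `s i` on `[0, T)` that are driven by an antisymmetric pair interaction `m`
of the size `s i * s j / (r * (r ^ 2 + s i * s j))`, where `r` is comparable with the mutual
distance, so that `|s i - s j| ≤ 2 * r`. -/
structure IsHeightSystem (a : ι → ℝ) (T K : ℝ) (s : ℝ → ι → ℝ) (r m : ℝ → ι → ι → ℝ) : Prop where
  weight_pos : ∀ i, 0 < a i
  pos : ∀ t ∈ Set.Ico 0 T, ∀ i, 0 < s t i
  deriv : ∀ t ∈ Set.Ico 0 T, ∀ i,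
    HasDerivWithinAt (fun τ => s τ i) (∑ j, a j * m t i j) (Set.Ico 0 T) t
  antisymm : ∀ t ∈ Set.Ico 0 T, ∀ i j, m t i j = -m t j i
  dist_pos : ∀ t ∈ Set.Ico 0 T, ∀ i j, i ≠ j → 0 < r t i j
  sub_le : ∀ t ∈ Set.Ico 0 T, ∀ i j, |s t i - s t j| ≤ 2 * r t i j
  interaction_le : ∀ t ∈ Set.Ico 0 T, ∀ i j, i ≠ j →
    |m t i j| ≤ K * (s t i * s t j / (r t i j * (r t i j ^ 2 + s t i * s t j)))

/-- An antisymmetric double sum only sees the differences of the weights. -/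
lemma two_mul_sum_sum_of_antisymm (a c : ι → ℝ) (m : ι → ι → ℝ) (hm : ∀ i j, m i j = -m j i) :
    2 * ∑ i, a i * (c i * ∑ j, a j * m i j) =
      ∑ i, ∑ j, a i * a j * ((c i - c j) * m i j) := by
  have h1 : ∑ i, a i * (c i * ∑ j, a j * m i j) = ∑ i, ∑ j, a i * a j * (c i * m i j) := by
    refine Finset.sum_congr rfl fun i _ => ?_
    rw [Finset.mul_sum, Finset.mul_sum]
    exact Finset.sum_congr rfl fun j _ => by ring
  have h2 : ∑ i, ∑ j, a i * a j * (c i * m i j) = ∑ i, ∑ j, a i * a j * (-(c j * m i j)) := by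
    rw [Finset.sum_comm]
    refine Finset.sum_congr rfl fun i _ => Finset.sum_congr rfl fun j _ => ?_
    rw [hm j i]; ring
  rw [two_mul, h1]
  nth_rewrite 2 [h2]
  simp only [← Finset.sum_add_distrib]
  exact Finset.sum_congr rfl fun i _ => Finset.sum_congr rfl fun j _ => by ring

namespace IsHeightSystem

variable {a : ι → ℝ} {T K : ℝ} {s : ℝ → ι → ℝ} {r m : ℝ → ι → ι → ℝ}

/-- The factor `2 * r` bounding the height difference cancels the singularity `1 / r` of the
interaction, and what remains is `s i * s j / (r ^ 2 + s i * s j) ≤ 1`. -/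
lemma dist_mul_interaction_le (h : IsHeightSystem a T K s r m) (hK : 0 ≤ K) {t : ℝ}
    (ht : t ∈ Set.Ico 0 T) (i j : ι) : |s t i - s t j| * |m t i j| ≤ 2 * K := by
  rcases eq_or_ne i j with rfl | hij
  · simp [hK]
  have hi := h.pos t ht i
  have hj := h.pos t ht j
  have hr := h.dist_pos t ht i j hij
  have hss : 0 < s t i * s t j := mul_pos hi hj
  have h1 : r t i j * (s t i * s t j / (r t i j * (r t i j ^ 2 + s t i * s t j))) ≤ 1 := by
    rw [← mul_div_assoc, mul_div_mul_left _ _ hr.ne', div_le_one (by positivity)]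
    nlinarith [sq_nonneg (r t i j)]
  calc |s t i - s t j| * |m t i j|
      ≤ (2 * r t i j) * (K * (s t i * s t j / (r t i j * (r t i j ^ 2 + s t i * s t j)))) :=
        mul_le_mul (h.sub_le t ht i j) (h.interaction_le t ht i j hij) (abs_nonneg _)
          (by positivity)
    _ = 2 * K * (r t i j * (s t i * s t j / (r t i j * (r t i j ^ 2 + s t i * s t j)))) := by ring
    _ ≤ 2 * K * 1 := by gcongr
    _ = 2 * K := mul_one _

lemma hasDerivWithinAt_sum (h : IsHeightSystem a T K s r m) {φ φ' : ι → ℝ → ℝ}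
    (hφ : ∀ i x, HasDerivAt (φ i) (φ' i x) x) {t : ℝ} (ht : t ∈ Set.Ico 0 T) :
    HasDerivWithinAt (fun τ => ∑ i, a i * φ i (s τ i))
      (∑ i, a i * (φ' i (s t i) * ∑ j, a j * m t i j)) (Set.Ico 0 T) t := by
  refine HasDerivWithinAt.fun_sum fun i _ => ?_
  exact ((hφ i (s t i)).comp_hasDerivWithinAt t (h.deriv t ht i)).const_mul (a i)

/-- After symmetrisation the derivative contains `(φ' (s i) - φ' (s j)) * m i j`, at most `L * (2 *
K)` in absolute value. The sum is therefore Lipschitz in time and extends continuously to `T`. -/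
lemma exists_tendsto_sum (h : IsHeightSystem a T K s r m) (hK : 0 ≤ K) (hT : 0 < T) {φ φ' : ℝ → ℝ}
    (hφ : ∀ x, HasDerivAt φ (φ' x) x) {L : NNReal} (hL : LipschitzWith L φ') :
    ∃ l, Tendsto (fun t => ∑ i, a i * φ (s t i)) (𝓝[<] T) (𝓝 l) := by
  have hderiv : ∀ t ∈ Set.Ico 0 T, HasDerivWithinAt (fun τ => ∑ i, a i * φ (s τ i))
      (∑ i, a i * (φ' (s t i) * ∑ j, a j * m t i j)) (Set.Ico 0 T) t := fun t ht =>
    h.hasDerivWithinAt_sum (φ := fun _ => φ) (φ' := fun _ => φ') (fun _ => hφ) ht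
  have hbound : ∀ t ∈ Set.Ico 0 T, ‖∑ i, a i * (φ' (s t i) * ∑ j, a j * m t i j)‖₊ ≤
      Real.toNNReal (∑ i, ∑ j, a i * a j * (L * K)) := by
    intro t ht
    rw [← NNReal.coe_le_coe, coe_nnnorm, Real.norm_eq_abs]
    refine le_trans ?_ (Real.le_coe_toNNReal _)
    have h2 := two_mul_sum_sum_of_antisymm a (fun i => φ' (s t i)) (m t) (h.antisymm t ht)
    have h3 : |∑ i, ∑ j, a i * a j * ((φ' (s t i) - φ' (s t j)) * m t i j)| ≤
        ∑ i, ∑ j, a i * a j * (L * (2 * K)) := by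
      refine (Finset.abs_sum_le_sum_abs _ _).trans (Finset.sum_le_sum fun i _ => ?_)
      refine (Finset.abs_sum_le_sum_abs _ _).trans (Finset.sum_le_sum fun j _ => ?_)
      have hij : 0 < a i * a j := mul_pos (h.weight_pos i) (h.weight_pos j)
      rw [abs_mul, abs_of_pos hij, abs_mul]
      refine mul_le_mul_of_nonneg_left ?_ hij.le
      have h4 := hL.dist_le_mul (s t i) (s t j)
      rw [Real.dist_eq, Real.dist_eq] at h4
      calc |φ' (s t i) - φ' (s t j)| * |m t i j| ≤ L * |s t i - s t j| * |m t i j| := by gcongr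
        _ = L * (|s t i - s t j| * |m t i j|) := by ring
        _ ≤ L * (2 * K) := by
          exact mul_le_mul_of_nonneg_left (h.dist_mul_interaction_le hK ht i j) L.2
    have h5 : ∑ i, ∑ j, a i * a j * (L * (2 * K)) = 2 * ∑ i, ∑ j, a i * a j * (L * K) := by
      simp only [Finset.mul_sum]
      exact Finset.sum_congr rfl fun i _ => Finset.sum_congr rfl fun j _ => by ring
    rw [← h2, h5, abs_mul, abs_two] at h3
    linarith
  have hlip := (convex_Ico 0 T).lipschitzOnWith_of_nnnorm_hasDerivWithin_le hderiv hbound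
  obtain ⟨g, hg, hgeq⟩ := hlip.extend_real
  refine ⟨g T, (hg.continuous.continuousAt.tendsto.mono_left nhdsWithin_le_nhds).congr' ?_⟩
  filter_upwards [Ico_mem_nhdsLT hT] with t ht using (hgeq ht).symm

/-- Every interval contains a level that no height takes at the end of the time interval. -/
lemma exists_avoided_level (h : IsHeightSystem a T K s r m) (hK : 0 ≤ K) (hT : 0 < T) {α β : ℝ}
    (hαβ : α < β) : ∃ c ∈ Set.Ioo α β, ∀ᶠ t in 𝓝[<] T, ∀ i, s t i ≠ c := by
  classical
  by_contra! hcon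
  set n := Fintype.card ι with hn
  -- This spacing fits `n + 1` levels, one more than there are heights, strictly inside `(α, β)`;
  -- bumps of outer radius `δ / 2` around them do not overlap.
  set δ : ℝ := (β - α) / (n + 2) with hδ
  have hδ0 : 0 < δ := div_pos (sub_pos.mpr hαβ) (by positivity)
  set c : Fin (n + 1) → ℝ := fun k => α + δ * ((k : ℕ) + 1) with hc
  have hcmem : ∀ k, c k ∈ Set.Ioo α β := by
    intro k
    have hk : ((k : ℕ) : ℝ) + 1 < n + 2 := by
      have : (k : ℕ) < n + 1 := k.2
      have : ((k : ℕ) : ℝ) < n + 1 := by exact_mod_cast this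
      linarith
    have h1 : δ * (n + 2) = β - α := by rw [hδ]; field_simp
    have h2 : δ * ((k : ℕ) + 1) < δ * (n + 2) := by gcongr
    have h3 : 0 < δ * ((k : ℕ) + 1) := by positivity
    exact ⟨by simp only [hc]; linarith, by simp only [hc]; linarith⟩
  have hcdist : ∀ k l, k ≠ l → δ ≤ |c k - c l| := by
    intro k l hkl
    have h1 : c k - c l = δ * (((k : ℕ) : ℤ) - ((l : ℕ) : ℤ) : ℤ) := by
      simp only [hc]; push_cast; ring
    have h2 : (1 : ℤ) ≤ |((k : ℕ) : ℤ) - ((l : ℕ) : ℤ)| := by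
      refine Int.one_le_abs ?_
      have : (k : ℕ) ≠ l := fun e => hkl (Fin.ext e)
      omega
    have h3 : (1 : ℝ) ≤ |((((k : ℕ) : ℤ) - ((l : ℕ) : ℤ) : ℤ) : ℝ)| := by exact_mod_cast h2
    rw [h1, abs_mul, abs_of_pos hδ0]
    nlinarith
  let φ : ∀ k : Fin (n + 1), ContDiffBump (c k) := fun k =>
    { rIn := δ / 4, rOut := δ / 2, rIn_pos := by positivity, rIn_lt_rOut := by linarith }
  obtain ⟨μ, hμ, hμa⟩ : ∃ μ > 0, ∀ i, μ ≤ a i := by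
    rcases isEmpty_or_nonempty ι with hι | hι
    · exact ⟨1, one_pos, fun i => hι.elim i⟩
    · obtain ⟨i, hi⟩ := Finite.exists_min a
      exact ⟨a i, h.weight_pos i, hi⟩
  -- A level hit at times accumulating at `T` makes its bump sum at least the smallest weight at
  -- those times. As the sum converges, it is eventually positive, so the bump is eventually always
  -- occupied.
  have hev : ∀ k, ∀ᶠ t in 𝓝[<] T, 0 < ∑ i, a i * φ k (s t i) := by
    intro k
    have hcd : ContDiff ℝ 2 (φ k) := (φ k).contDiff
    have hcd' : ContDiff ℝ 1 (_root_.deriv (φ k)) :=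
      ((contDiff_succ_iff_deriv (n := 1)).mp (by exact_mod_cast hcd)).2.2
    obtain ⟨L, hL⟩ := hcd'.lipschitzWith_of_hasCompactSupport
      (φ k).hasCompactSupport.deriv one_ne_zero
    obtain ⟨l, hl⟩ := h.exists_tendsto_sum hK hT
      (fun x => (hcd.differentiable (by norm_num) x).hasDerivAt) hL
    have hμl : μ ≤ l := by
      refine ge_of_tendsto_of_frequently hl ?_
      refine (hcon (c k) (hcmem k)).mono ?_
      rintro t ⟨i, hi⟩
      have h1 : φ k (s t i) = 1 := by
        rw [hi]
        exact (φ k).one_of_mem_closedBall (Metric.mem_closedBall_self (φ k).rIn_pos.le)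
      calc μ ≤ a i * φ k (s t i) := by rw [h1, mul_one]; exact hμa i
        _ ≤ ∑ i, a i * φ k (s t i) := Finset.single_le_sum
          (f := fun i => a i * φ k (s t i))
          (fun j _ => mul_nonneg (h.weight_pos j).le (φ k).nonneg) (Finset.mem_univ i)
    exact hl.eventually_const_lt (hμ.trans_le hμl)
  obtain ⟨t, ht⟩ := (eventually_all.mpr hev).exists
  have hex : ∀ k, ∃ i, |s t i - c k| < δ / 2 := by
    intro k
    by_contra! hk
    refine (ht k).ne' (Finset.sum_eq_zero fun i _ => ?_)
    rw [(φ k).zero_of_le_dist (by rw [Real.dist_eq]; exact hk i), mul_zero]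
  choose f hf using hex
  -- All `n + 1` disjoint bumps are occupied at one common time, by only `n` heights.
  obtain ⟨k, l, hkl, hfkl⟩ := Fintype.exists_ne_map_eq_of_card_lt f (by simp [hn])
  have h1 := hf k
  have h2 := hf l
  rw [← hfkl] at h2
  have h3 := hcdist k l hkl
  have h4 := abs_sub_le (c k) (s t (f k)) (c l)
  rw [abs_sub_comm (c k) (s t (f k))] at h4
  linarith

lemma continuousOn (h : IsHeightSystem a T K s r m) (i : ι) :
    ContinuousOn (fun t => s t i) (Set.Ico 0 T) :=
  fun t ht => (h.deriv t ht i).continuousWithinAt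

/-- Once an avoided level `c < b` is no longer hit, a height that is below `c` at one later time
stays below it by the intermediate value theorem. -/
lemma tendsto_zero_of_frequently (h : IsHeightSystem a T K s r m) (hK : 0 ≤ K) (hT : 0 < T)
    {i : ι} (hi : ∀ ε > 0, ∃ᶠ t in 𝓝[<] T, s t i < ε) :
    Tendsto (fun t => s t i) (𝓝[<] T) (𝓝 0) := by
  have hmem : Set.Ico 0 T ∈ 𝓝[<] T := Ico_mem_nhdsLT hT
  rw [tendsto_order]
  refine ⟨fun b hb => ?_, fun b hb => ?_⟩
  · filter_upwards [hmem] with t ht using hb.trans (h.pos t ht i)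
  obtain ⟨c, hc, hav⟩ := h.exists_avoided_level hK hT hb
  obtain ⟨t₀, ht₀, hav⟩ := (mem_nhdsLT_iff_exists_Ico_subset).mp hav
  obtain ⟨t₁, hlt, ht₁⟩ := ((hi c hc.1).and_eventually
    (inter_mem hmem (Ico_mem_nhdsLT ht₀))).exists
  filter_upwards [Ico_mem_nhdsLT ht₁.1.2] with t ht
  by_contra! hle
  have hsub : Set.Icc t₁ t ⊆ Set.Ico 0 T := fun τ hτ =>
    ⟨ht₁.1.1.trans hτ.1, hτ.2.trans_lt ht.2⟩
  obtain ⟨τ, hτ, hτc⟩ := intermediate_value_Icc ht.1 ((h.continuousOn i).mono hsub)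
    ⟨hlt.le, hc.2.le.trans hle⟩
  exact hav ⟨ht₁.2.1.trans hτ.1, hτ.2.trans_lt ht.2⟩ i hτc

/-- Vortices that descend to the boundary are eventually separated from the others, so the
weighted sum of their heights decays at most exponentially. -/
lemma eventually_le (h : IsHeightSystem a T K s r m) (hK : 0 ≤ K) (hT : 0 < T) (i : ι) :
    ∃ ε > 0, ∀ᶠ t in 𝓝[<] T, ε ≤ s t i := by
  classical
  have hmem : Set.Ico 0 T ∈ 𝓝[<] T := Ico_mem_nhdsLT hT
  have hdich : ∀ j, Tendsto (fun t => s t j) (𝓝[<] T) (𝓝 0) ∨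
      ∃ ε > 0, ∀ᶠ t in 𝓝[<] T, ε ≤ s t j := by
    intro j
    by_cases hj : ∀ ε > 0, ∃ᶠ t in 𝓝[<] T, s t j < ε
    · exact Or.inl (h.tendsto_zero_of_frequently hK hT hj)
    · push Not at hj
      exact Or.inr hj
  refine (hdich i).resolve_left fun hi => ?_
  set J : Finset ι := Finset.univ.filter fun j => Tendsto (fun t => s t j) (𝓝[<] T) (𝓝 0) with hJ
  have hJmem : ∀ j, j ∈ J ↔ Tendsto (fun t => s t j) (𝓝[<] T) (𝓝 0) := by simp [hJ]
  have hout : ∀ j, ∃ ε > 0, j ∉ J → ∀ᶠ t in 𝓝[<] T, ε ≤ s t j := by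
    intro j
    rcases hdich j with hj | ⟨ε, hε, hj⟩
    · exact ⟨1, one_pos, fun hjJ => absurd ((hJmem j).mpr hj) hjJ⟩
    · exact ⟨ε, hε, fun _ => hj⟩
  choose e he hout using hout
  obtain ⟨ε, hε, hεe⟩ : ∃ ε > 0, ∀ j, ε ≤ e j := by
    have : Nonempty ι := ⟨i⟩
    obtain ⟨k, hk⟩ := Finite.exists_min e
    exact ⟨e k, he k, hk⟩
  have hev : ∀ᶠ t in 𝓝[<] T, ∀ j, (j ∈ J → s t j ≤ ε / 2) ∧ (j ∉ J → ε ≤ s t j) := by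
    refine eventually_all.mpr fun j => ?_
    by_cases hj : j ∈ J
    · filter_upwards [((hJmem j).mp hj).eventually_lt_const (half_pos hε)] with t ht
      exact ⟨fun _ => ht.le, fun hj' => absurd hj hj'⟩
    · filter_upwards [hout j hj] with t ht
      exact ⟨fun hj' => absurd hj' hj, fun _ => (hεe j).trans ht⟩
  obtain ⟨t₀, ht₀, hsub⟩ := mem_nhdsLT_iff_exists_Ico_subset.mp
    (inter_mem hmem hev)
  have ht₀T : t₀ < T := ht₀
  have ht₀mem : t₀ ∈ Set.Ico 0 T := (hsub ⟨le_rfl, ht₀T⟩).1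
  -- For `j ∈ J` and `k ∉ J` the gap gives `s k ≤ 2 * (s k - s j) ≤ 4 * r` and `r ≥ ε / 4`, so the
  -- interaction is at most `K * s j * 4 / (ε / 4) ^ 2`.
  set C : ℝ := K * (64 / ε ^ 2) with hC
  have hC0 : 0 ≤ C := by positivity
  have hm : ∀ t ∈ Set.Ico t₀ T, ∀ j ∈ J, ∀ k ∉ J, |m t j k| ≤ C * s t j := by
    intro t ht j hj k hk
    obtain ⟨htT, hts⟩ := hsub ht
    have hjk : j ≠ k := fun e => hk (e ▸ hj)
    have h1 := (hts j).1 hj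
    have h2 := (hts k).2 hk
    have hsj := h.pos t htT j
    have hsk := h.pos t htT k
    have hr := h.dist_pos t htT j k hjk
    have h3 := (abs_sub_comm _ _).trans_le (h.sub_le t htT j k)
    have h4 := (le_abs_self _).trans h3
    have h5 : s t k ≤ 4 * r t j k := by linarith
    have h6 : ε / 4 ≤ r t j k := by linarith
    refine (h.interaction_le t htT j k hjk).trans ?_
    rw [hC, mul_assoc]
    refine mul_le_mul_of_nonneg_left ?_ hK
    rw [div_le_iff₀ (by positivity)]
    have h7 : (ε / 4) ^ 2 ≤ r t j k ^ 2 + s t j * s t k := by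
      have := mul_pos hsj hsk
      have := pow_le_pow_left₀ (by positivity) h6 2
      linarith
    calc s t j * s t k ≤ s t j * (4 * r t j k) := by gcongr
      _ = 64 / ε ^ 2 * s t j * (r t j k * (ε / 4) ^ 2) := by field_simp; ring
      _ ≤ 64 / ε ^ 2 * s t j * (r t j k * (r t j k ^ 2 + s t j * s t k)) := by gcongr
  set Y : ℝ → ℝ := fun t => ∑ j, a j * (if j ∈ J then s t j else 0) with hY
  set W : ℝ := ∑ k, a k with hW
  have hYderiv : ∀ t ∈ Set.Ico 0 T, HasDerivWithinAt Y
      (∑ j, a j * ((if j ∈ J then 1 else 0) * ∑ k, a k * m t j k)) (Set.Ico 0 T) t := by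
    intro t ht
    refine h.hasDerivWithinAt_sum (φ := fun j x => if j ∈ J then x else 0)
      (φ' := fun j _ => if j ∈ J then 1 else 0) (fun j x => ?_) ht
    by_cases hj : j ∈ J
    · simpa [hj] using hasDerivAt_id' x
    · simpa [hj] using hasDerivAt_const x (0 : ℝ)
  -- The indicator differences vanish for pairs inside `J` and pairs outside `J`; only mixed pairs
  -- remain, each controlled by the height of its member in `J`.
  have hYlower : ∀ t ∈ Set.Ico t₀ T, -(C * W) * Y t ≤
      ∑ j, a j * ((if j ∈ J then 1 else 0) * ∑ k, a k * m t j k) := by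
    intro t ht
    have htT := (hsub ht).1
    have h2 := two_mul_sum_sum_of_antisymm a (fun j => if j ∈ J then 1 else 0) (m t)
      (h.antisymm t htT)
    have h3 : ∑ j, ∑ k, a j * a k * (-(C * (if j ∈ J then s t j else 0)) +
        -(C * (if k ∈ J then s t k else 0))) ≤ ∑ j, ∑ k, a j * a k *
        (((if j ∈ J then 1 else 0) - (if k ∈ J then 1 else 0)) * m t j k) := by
      refine Finset.sum_le_sum fun j _ => Finset.sum_le_sum fun k _ => ?_
      refine mul_le_mul_of_nonneg_left ?_ (mul_pos (h.weight_pos j) (h.weight_pos k)).le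
      have hj0 := mul_nonneg hC0 (h.pos t htT j).le
      have hk0 := mul_nonneg hC0 (h.pos t htT k).le
      by_cases hj : j ∈ J <;> by_cases hk : k ∈ J
      · simp only [hj, hk, if_true]; linarith
      · have := neg_le_of_abs_le (hm t ht j hj k hk)
        simp only [hj, hk, if_true, if_false]; linarith
      · have := neg_le_of_abs_le (hm t ht k hk j hj)
        have := h.antisymm t htT j k
        simp only [hj, hk, if_true, if_false]; linarith
      · simp only [hj, hk, if_false]; linarith
    have h4 : ∑ j, ∑ k, a j * a k * (-(C * (if j ∈ J then s t j else 0)) +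
        -(C * (if k ∈ J then s t k else 0))) = 2 * (-(C * W) * Y t) := by
      have e1 : ∑ j, ∑ k, a j * a k * (C * (if j ∈ J then s t j else 0)) = C * W * Y t := by
        simp only [hW, hY, Finset.mul_sum, Finset.sum_mul]
        exact Finset.sum_congr rfl fun j _ => Finset.sum_congr rfl fun k _ => by ring
      have e2 : ∑ j, ∑ k, a j * a k * (C * (if k ∈ J then s t k else 0)) = C * W * Y t := by
        rw [← e1, Finset.sum_comm]
        exact Finset.sum_congr rfl fun j _ => Finset.sum_congr rfl fun k _ => by ring
      have e3 : ∀ j k, a j * a k * (-(C * (if j ∈ J then s t j else 0)) +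
          -(C * (if k ∈ J then s t k else 0))) = -(a j * a k * (C * (if j ∈ J then s t j else 0)))
          + -(a j * a k * (C * (if k ∈ J then s t k else 0))) := fun j k => by ring
      simp only [e3, Finset.sum_add_distrib, Finset.sum_neg_distrib, e1, e2]
      ring
    linarith
  set D : ℝ := C * W with hD
  have hmono : MonotoneOn (fun t => Real.exp (D * t) * Y t) (Set.Ico t₀ T) := by
    have hd : ∀ t ∈ Set.Ico t₀ T, HasDerivWithinAt (fun t => Real.exp (D * t) * Y t)
        (Real.exp (D * t) * D * Y t + Real.exp (D * t) *
          (∑ j, a j * ((if j ∈ J then 1 else 0) * ∑ k, a k * m t j k))) (Set.Ico t₀ T) t := by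
      intro t ht
      have h1 : HasDerivAt (fun t => Real.exp (D * t)) (Real.exp (D * t) * D) t := by
        simpa using ((hasDerivAt_id t).const_mul D).exp
      exact h1.hasDerivWithinAt.mul
        ((hYderiv t (hsub ht).1).mono (Set.Ico_subset_Ico_left ht₀mem.1))
    refine monotoneOn_of_hasDerivWithinAt_nonneg (convex_Ico _ _)
      (fun t ht => (hd t ht).continuousWithinAt)
      (fun t ht => (hd t (interior_subset ht)).mono interior_subset) fun t ht => ?_
    have h1 := hYlower t (interior_subset ht)
    have h2 := Real.exp_pos (D * t)
    nlinarith
  have hY0 : 0 < Y t₀ := by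
    have hnn : ∀ j ∈ Finset.univ, 0 ≤ a j * (if j ∈ J then s t₀ j else 0) := by
      intro j _
      have := h.pos t₀ ht₀mem j
      have := h.weight_pos j
      split_ifs <;> positivity
    refine Finset.sum_pos' hnn ⟨i, Finset.mem_univ i, ?_⟩
    rw [if_pos ((hJmem i).mpr hi)]
    exact mul_pos (h.weight_pos i) (h.pos t₀ ht₀mem i)
  have hYlim : Tendsto Y (𝓝[<] T) (𝓝 0) := by
    have : Tendsto Y (𝓝[<] T) (𝓝 (∑ j : ι, a j * 0)) := by
      refine tendsto_finsetSum _ fun j _ => Tendsto.const_mul _ ?_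
      by_cases hj : j ∈ J
      · simpa [hj] using (hJmem j).mp hj
      · simp [hj]
    simpa using this
  have hlim : Tendsto (fun t => Real.exp (D * t) * Y t) (𝓝[<] T) (𝓝 0) := by
    have h1 : Continuous fun t => Real.exp (D * t) := by fun_prop
    simpa using (h1.continuousAt.tendsto.mono_left nhdsWithin_le_nhds).mul hYlim
  -- A nondecreasing function with limit zero cannot start from the positive value at `t₀`.
  have hge : Real.exp (D * t₀) * Y t₀ ≤ 0 := by
    refine ge_of_tendsto hlim ?_
    filter_upwards [Ico_mem_nhdsLT ht₀T] with t ht using hmono ⟨le_rfl, ht₀T⟩ ht ht.1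
  exact absurd hge (not_le.mpr (mul_pos (Real.exp_pos _) hY0))

/-- The heights stay away from zero. -/
theorem exists_lower_bound (h : IsHeightSystem a T K s r m) (hK : 0 ≤ K) (hT : 0 < T) :
    ∃ c > 0, ∀ t ∈ Set.Ico 0 T, ∀ i, c ≤ s t i := by
  have hone : ∀ i, ∃ c > 0, ∀ t ∈ Set.Ico 0 T, c ≤ s t i := by
    intro i
    obtain ⟨ε, hε, hev⟩ := h.eventually_le hK hT i
    obtain ⟨t₀, ht₀, hsub⟩ := mem_nhdsLT_iff_exists_Ico_subset.mp
      (inter_mem (Ico_mem_nhdsLT hT) hev)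
    have ht₀0 : 0 ≤ t₀ := (hsub ⟨le_rfl, ht₀⟩).1.1
    obtain ⟨τ, hτ, hmin⟩ := isCompact_Icc.exists_isMinOn (Set.nonempty_Icc.mpr ht₀0)
      ((h.continuousOn i).mono fun t (ht : t ∈ Set.Icc 0 t₀) => ⟨ht.1, ht.2.trans_lt ht₀⟩)
    refine ⟨min ε (s τ i), lt_min hε (h.pos τ ⟨hτ.1, hτ.2.trans_lt ht₀⟩ i), fun t ht => ?_⟩
    rcases le_total t t₀ with hle | hle
    · exact (min_le_right _ _).trans (hmin ⟨ht.1, hle⟩)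
    · exact (min_le_left _ _).trans (hsub ⟨hle, ht.2⟩).2
  choose c hc hcs using hone
  rcases isEmpty_or_nonempty ι with hι | hι
  · exact ⟨1, one_pos, fun t _ i => hι.elim i⟩
  · obtain ⟨k, hk⟩ := Finite.exists_min c
    exact ⟨c k, hc k, fun t ht i => (hk i).trans (hcs i t ht)⟩

end IsHeightSystem
end HeightSystem

/-! ### The vortex field in terms of a height function -/

noncomputable section VectorField

/-- A smooth function `s` on the plane with the gradient `D`, positive on a domain and vanishing
on its boundary, that plays the role of the height above the boundary. -/
structure IsHeight (s : ℂ → ℝ) (D : ℂ → ℂ) : Prop where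
  grad : ∀ x, HasGradientAt s (D x) x
  contDiff : ContDiff ℝ 1 s
  contDiff_grad : ContDiff ℝ 1 D
  inner_rotation : ∀ x y, inner ℝ (D x - D y) (I * (x - y)) = 0
  sub_le : ∀ x y, 0 ≤ s x → 0 ≤ s y → |s x - s y| ≤ 2 * ‖x - y‖
  norm_grad_le : ∀ x, 0 ≤ s x → ‖D x‖ ≤ 2

lemma inner_I_mul_self (z : ℂ) : inner ℝ z (I * z) = 0 := by
  rw [Complex.inner]
  simp
  ring

/-- The squared distance of `x` to the reflection of `y`, suitably normalised. -/
def imageDistSq (s : ℂ → ℝ) (x y : ℂ) : ℝ := ‖x - y‖ ^ 2 + s x * s y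

/-- The interaction energy of two vortices. On the diagonal the value `log 0 = 0` makes it the
energy `-(2π)⁻¹ log s` of the self-interaction. -/
def pairEnergy (s : ℂ → ℝ) (x y : ℂ) : ℝ :=
  1 / (4 * Real.pi) * (Real.log (‖x - y‖ ^ 2) - Real.log (imageDistSq s x y))

/-- The gradient of `pairEnergy` in the first variable; on the diagonal half the gradient of the
self-interaction. -/
def pairForce (s : ℂ → ℝ) (D : ℂ → ℂ) (x y : ℂ) : ℂ :=
  (1 / (4 * Real.pi)) • ((2 / ‖x - y‖ ^ 2) • (x - y) -
    (1 / imageDistSq s x y) • ((2 : ℝ) • (x - y) + s y • D x))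

variable {N : ℕ}

/-- The configurations of pairwise distinct vortices at positive height. -/
def phaseSpace (N : ℕ) (s : ℂ → ℝ) : Set (Fin N → ℂ) :=
  {x | (∀ i, 0 < s (x i)) ∧ ∀ i j, i ≠ j → x i ≠ x j}

/-- The gradient of the energy in the position of the `i`-th vortex, divided by `a i`. -/
def totalForce (s : ℂ → ℝ) (D : ℂ → ℂ) (a : Fin N → ℝ) (x : Fin N → ℂ) (i : Fin N) : ℂ :=
  ∑ j, a j • pairForce s D (x i) (x j)

/-- The vector field of the point-vortex dynamics. -/
def vortexField (s : ℂ → ℝ) (D : ℂ → ℂ) (a : Fin N → ℝ) (x : Fin N → ℂ) : Fin N → ℂ :=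
  fun i => I * totalForce s D a x i

variable {s : ℂ → ℝ} {D : ℂ → ℂ}

lemma imageDistSq_comm (x y : ℂ) : imageDistSq s x y = imageDistSq s y x := by
  rw [imageDistSq, imageDistSq, norm_sub_rev, mul_comm (s x)]

lemma imageDistSq_pos {x y : ℂ} (hx : 0 < s x) (hy : 0 < s y) : 0 < imageDistSq s x y := by
  unfold imageDistSq
  positivity

/-- The image part of the force along `D x` is rotated to a vector orthogonal to `D x`, so only the
multiples of `x - y` contribute to the change of height. -/
lemma inner_grad_pairForce (x y : ℂ) :
    inner ℝ (D x) (I * pairForce s D x y) = 1 / (2 * Real.pi) *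
      (1 / ‖x - y‖ ^ 2 - 1 / imageDistSq s x y) * inner ℝ (D x) (I * (x - y)) := by
  have e : I * pairForce s D x y = (1 / (4 * Real.pi)) • ((2 / ‖x - y‖ ^ 2) • (I * (x - y)) -
      (1 / imageDistSq s x y) • ((2 : ℝ) • (I * (x - y)) + s y • (I * D x))) := by
    simp only [pairForce, Complex.real_smul]; ring
  rw [e]
  simp only [real_inner_smul_right, inner_sub_right, inner_add_right, inner_I_mul_self]
  ring

lemma pairForce_self {x : ℂ} (hx : 0 < s x) :
    pairForce s D x x = (-(1 / (4 * Real.pi)) / s x) • D x := by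
  simp only [pairForce, imageDistSq, sub_self, norm_zero, smul_zero, zero_add, zero_sub, smul_neg,
    ne_eq, OfNat.ofNat_ne_zero, not_false_eq_true, zero_pow, smul_smul]
  rw [← neg_smul]
  congr 1
  field_simp

namespace IsHeight

lemma hasDerivWithinAt_comp (h : IsHeight s D) {x : ℝ → ℂ} {x' : ℂ} {S : Set ℝ} {t : ℝ}
    (hx : HasDerivWithinAt x x' S t) :
    HasDerivWithinAt (fun τ => s (x τ)) (inner ℝ (D (x t)) x') S t := by
  exact ((h.grad (x t)).hasFDerivAt.comp_hasDerivWithinAt t hx).congr_deriv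
    InnerProductSpace.toDual_apply_apply

lemma hasDerivWithinAt_imageDistSq (h : IsHeight s D) {x y : ℝ → ℂ} {x' y' : ℂ} {S : Set ℝ}
    {t : ℝ} (hx : HasDerivWithinAt x x' S t) (hy : HasDerivWithinAt y y' S t) :
    HasDerivWithinAt (fun τ => imageDistSq s (x τ) (y τ))
      (2 * inner ℝ (x t - y t) (x' - y') + (inner ℝ (D (x t)) x' * s (y t) +
        s (x t) * inner ℝ (D (y t)) y')) S t :=
  (hx.sub hy).norm_sq.add ((h.hasDerivWithinAt_comp hx).mul (h.hasDerivWithinAt_comp hy))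

/-- The alternative `x = y` of curves treats the self-energy in the same formula: there the singular
logarithm is the constant `log 0 = 0`, and the two equal halves of the diagonal force add up. -/
lemma hasDerivWithinAt_pairEnergy (h : IsHeight s D) {x y : ℝ → ℂ} {x' y' : ℂ} {S : Set ℝ}
    {t : ℝ} (hx : HasDerivWithinAt x x' S t) (hy : HasDerivWithinAt y y' S t)
    (hxp : 0 < s (x t)) (hyp : 0 < s (y t)) (hxy : x t ≠ y t ∨ x = y) :
    HasDerivWithinAt (fun τ => pairEnergy s (x τ) (y τ))
      (inner ℝ (pairForce s D (x t) (y t)) x' + inner ℝ (pairForce s D (y t) (x t)) y') S t := by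
  have hB := imageDistSq_pos hxp hyp
  have h2 := (h.hasDerivWithinAt_imageDistSq hx hy).log hB.ne'
  have h1 : HasDerivWithinAt (fun τ => Real.log (‖x τ - y τ‖ ^ 2))
      (2 * inner ℝ (x t - y t) (x' - y') / ‖x t - y t‖ ^ 2) S t := by
    rcases hxy with hxy | rfl
    · have : ‖x t - y t‖ ^ 2 ≠ 0 := by simpa [sub_eq_zero] using hxy
      exact (hx.sub hy).norm_sq.log this
    · simpa using hasDerivWithinAt_const t S (0 : ℝ)
  refine ((h1.sub h2).const_mul (1 / (4 * Real.pi))).congr_deriv ?_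
  have e : y t - x t = -(x t - y t) := by ring
  simp only [pairForce, imageDistSq_comm (y t) (x t), norm_sub_rev (y t) (x t)]
  simp only [e, real_inner_smul_left, inner_sub_left, inner_add_left, inner_neg_left, smul_neg,
    inner_sub_right]
  ring

lemma hasGradientAt_pairEnergy (h : IsHeight s D) {x y : ℂ} (hx : 0 < s x) (hy : 0 < s y)
    (hxy : x ≠ y) : HasGradientAt (fun z => pairEnergy s z y) (pairForce s D x y) x := by
  have hB := imageDistSq_pos hx hy
  have hA : ‖x - y‖ ^ 2 ≠ 0 := by simpa [sub_eq_zero] using hxy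
  have h0 : HasFDerivAt (fun z : ℂ => ‖z - y‖ ^ 2) _ x := ((hasFDerivAt_id x).sub_const y).norm_sq
  have h1 := h0.log hA
  have h2 : HasFDerivAt (fun z => imageDistSq s z y) _ x :=
    h0.add ((h.grad x).hasFDerivAt.mul_const (s y))
  have h3 := (h1.sub (h2.log hB.ne')).const_mul (1 / (4 * Real.pi))
  rw [hasGradientAt_iff_hasFDerivAt]
  refine h3.congr_fderiv ?_
  ext v
  · simp [pairForce, InnerProductSpace.toDual_apply_apply, -Complex.inner, -Complex.real_smul]
    ring

lemma contDiffAt_vortexField (h : IsHeight s D) (a : Fin N → ℝ) {x : Fin N → ℂ}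
    (hx : x ∈ phaseSpace N s) : ContDiffAt ℝ 1 (vortexField s D a) x := by
  have hp : ∀ i, ContDiffAt ℝ 1 (fun u : Fin N → ℂ => u i) x := fun i => by fun_prop
  have hs : ∀ i, ContDiffAt ℝ 1 (fun u : Fin N → ℂ => s (u i)) x := fun i =>
    h.contDiff.contDiffAt.comp x (hp i)
  have hD : ∀ i, ContDiffAt ℝ 1 (fun u : Fin N → ℂ => D (u i)) x := fun i =>
    h.contDiff_grad.contDiffAt.comp x (hp i)
  have hn : ∀ i j, ContDiffAt ℝ 1 (fun u : Fin N → ℂ => ‖u i - u j‖ ^ 2) x := fun i j =>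
    ((hp i).sub (hp j)).norm_sq ℝ
  refine contDiffAt_pi.mpr fun i => contDiffAt_const.mul (ContDiffAt.sum fun j _ =>
    ContDiffAt.const_smul (a j)
      (ContDiffAt.const_smul (1 / (4 * Real.pi)) (ContDiffAt.sub ?_ ?_)))
  · rcases eq_or_ne i j with rfl | hij
    · simpa using contDiffAt_const
    · refine (contDiffAt_const.div (hn i j) ?_).smul ((hp i).sub (hp j))
      simpa [sub_eq_zero] using hx.2 i j hij
  · refine (contDiffAt_const.div ((hn i j).add ((hs i).mul (hs j))) ?_).smul
      ((ContDiffAt.const_smul (2 : ℝ) ((hp i).sub (hp j))).add ((hs j).fun_smul (hD i)))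
    exact (imageDistSq_pos (hx.1 i) (hx.1 j)).ne'

lemma isOpen_phaseSpace (h : IsHeight s D) : IsOpen (phaseSpace N s) := by
  have hc := h.contDiff.continuous
  have e : phaseSpace N s = (⋂ i, {x | 0 < s (x i)}) ∩
      ⋂ i, ⋂ j, {x | i ≠ j → x i ≠ x j} := by
    ext x; simp [phaseSpace]
  rw [e]
  refine (isOpen_iInter_of_finite fun i => isOpen_lt continuous_const (by fun_prop)).inter
    (isOpen_iInter_of_finite fun i => isOpen_iInter_of_finite fun j => ?_)
  by_cases hij : i = j
  · simp [hij]
  · simpa [hij] using isOpen_ne_fun (continuous_apply i) (continuous_apply j)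

/-- Antisymmetry comes from `inner_rotation`, the infinitesimal form of the translation or rotation
symmetry. The size bound comes from `1 / r² - 1 / (r² + s i * s j)`, whose numerator over the common
denominator is `s i * s j`. -/
lemma isHeightSystem (h : IsHeight s D) {a : Fin N → ℝ} (ha : ∀ i, 0 < a i) {T : ℝ}
    {x : ℝ → Fin N → ℂ}
    (hx : IsFlowLine (phaseSpace N s) (vortexField s D a) (Set.Ico 0 T) x) :
    IsHeightSystem a T (1 / Real.pi) (fun t i => s (x t i)) (fun t i j => ‖x t i - x t j‖)
      (fun t i j => inner ℝ (D (x t i)) (I * pairForce s D (x t i) (x t j))) where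
  weight_pos := ha
  pos t ht i := (hx.mem t ht).1 i
  deriv t ht i := by
    refine (h.hasDerivWithinAt_comp (hasDerivWithinAt_pi.mp (hx.ode t ht) i)).congr_deriv ?_
    rw [vortexField, totalForce, Finset.mul_sum, inner_sum]
    refine Finset.sum_congr rfl fun j _ => ?_
    rw [mul_smul_comm, real_inner_smul_right]
  antisymm t ht i j := by
    have h1 := h.inner_rotation (x t i) (x t j)
    have e : x t j - x t i = -(x t i - x t j) := by ring
    rw [inner_sub_left] at h1
    rw [inner_grad_pairForce, inner_grad_pairForce, imageDistSq_comm (x t j), norm_sub_rev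
      (x t j), e, mul_neg, inner_neg_right, ← sub_eq_zero.mp h1]
    ring
  dist_pos t ht i j hij := norm_pos_iff.mpr (sub_ne_zero.mpr ((hx.mem t ht).2 i j hij))
  sub_le t ht i j := h.sub_le _ _ ((hx.mem t ht).1 i).le ((hx.mem t ht).1 j).le
  interaction_le t ht i j hij := by
    have hi := (hx.mem t ht).1 i
    have hj := (hx.mem t ht).1 j
    have hr : 0 < ‖x t i - x t j‖ := norm_pos_iff.mpr (sub_ne_zero.mpr ((hx.mem t ht).2 i j hij))
    have hB := imageDistSq_pos hi hj
    have h1 : |inner ℝ (D (x t i)) (I * (x t i - x t j))| ≤ 2 * ‖x t i - x t j‖ := by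
      refine (abs_real_inner_le_norm _ _).trans ?_
      rw [norm_mul, norm_I, one_mul]
      gcongr
      exact h.norm_grad_le _ hi.le
    have h2 : 1 / ‖x t i - x t j‖ ^ 2 - 1 / imageDistSq s (x t i) (x t j) =
        s (x t i) * s (x t j) / (‖x t i - x t j‖ ^ 2 * imageDistSq s (x t i) (x t j)) := by
      rw [div_sub_div _ _ (by positivity) hB.ne']
      congr 1
      simp only [imageDistSq]; ring
    rw [inner_grad_pairForce, h2, abs_mul, abs_of_pos (by positivity)]
    calc _ ≤ 1 / (2 * Real.pi) * (s (x t i) * s (x t j) / (‖x t i - x t j‖ ^ 2 *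
          imageDistSq s (x t i) (x t j))) * (2 * ‖x t i - x t j‖) := by gcongr
      _ = _ := by
        rw [← imageDistSq]
        field_simp

end IsHeight
end VectorField

/-! ### Conservation of energy and confinement to a compact set -/

noncomputable section Confinement

variable {N : ℕ} {s : ℂ → ℝ} {D : ℂ → ℂ} {a : Fin N → ℝ} {T : ℝ} {x : ℝ → Fin N → ℂ}

/-- The Hamiltonian of the point-vortex dynamics. -/
def energy (s : ℂ → ℝ) (a : Fin N → ℝ) (x : Fin N → ℂ) : ℝ :=
  ∑ i, ∑ j, a i * a j * (1 / 2 * pairEnergy s (x i) (x j))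

lemma pairEnergy_self_le {c : ℝ} (hc : 0 < c) {z : ℂ} (hz : c ≤ s z) :
    pairEnergy s z z ≤ -(1 / (2 * Real.pi)) * Real.log c := by
  have h1 : pairEnergy s z z = -(1 / (2 * Real.pi)) * Real.log (s z) := by
    have : s z ≠ 0 := (hc.trans_le hz).ne'
    rw [pairEnergy, imageDistSq, sub_self, norm_zero, zero_pow two_ne_zero, zero_add,
      Real.log_mul this this, Real.log_zero]
    ring
  rw [h1]
  have h2 := Real.log_le_log hc hz
  have h3 : 0 < 1 / (2 * Real.pi) := by positivity
  nlinarith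

lemma pairEnergy_nonpos {z w : ℂ} (hz : 0 < s z) (hw : 0 < s w) (hzw : z ≠ w) :
    pairEnergy s z w ≤ 0 := by
  have hA : 0 < ‖z - w‖ ^ 2 := by
    have := norm_pos_iff.mpr (sub_ne_zero.mpr hzw)
    positivity
  have h1 : ‖z - w‖ ^ 2 ≤ imageDistSq s z w := by
    have := mul_pos hz hw
    unfold imageDistSq; linarith
  have h2 := Real.log_le_log hA h1
  have h3 : 0 < 1 / (4 * Real.pi) := by positivity
  unfold pairEnergy
  nlinarith

namespace IsHeight

/-- Each velocity is the quarter-turn of the total force on that vortex, hence orthogonal to it;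
both halves of the derivative of the symmetric double sum vanish. -/
lemma energy_eq (h : IsHeight s D)
    (hx : IsFlowLine (phaseSpace N s) (vortexField s D a) (Set.Ico 0 T) x) {t : ℝ}
    (ht : t ∈ Set.Ico 0 T) : energy s a (x t) = energy s a (x 0) := by
  have hderiv : ∀ t ∈ Set.Ico 0 T,
      HasDerivWithinAt (fun τ => energy s a (x τ)) 0 (Set.Ico 0 T) t := by
    intro t ht
    have hode := hasDerivWithinAt_pi.mp (hx.ode t ht)
    have hmem := hx.mem t ht
    set f : Fin N → Fin N → ℂ := fun i j => pairForce s D (x t i) (x t j) with hf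
    set w : Fin N → ℂ := totalForce s D a (x t) with hw
    have h1 : HasDerivWithinAt (fun τ => energy s a (x τ))
        (∑ i, ∑ j, a i * a j * (1 / 2 *
          (inner ℝ (f i j) (I * w i) + inner ℝ (f j i) (I * w j)))) (Set.Ico 0 T) t := by
      refine HasDerivWithinAt.fun_sum fun i _ => HasDerivWithinAt.fun_sum fun j _ => ?_
      refine ((h.hasDerivWithinAt_pairEnergy (hode i) (hode j) (hmem.1 i) (hmem.1 j)
        ?_).const_mul (1 / 2)).const_mul (a i * a j)
      rcases eq_or_ne i j with rfl | hij
      · exact Or.inr rfl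
      · exact Or.inl (hmem.2 i j hij)
    have h2 : ∑ i, ∑ j, a i * a j * inner ℝ (f i j) (I * w i) = 0 := by
      refine Finset.sum_eq_zero fun i _ => ?_
      have e : ∑ j, a i * a j * inner ℝ (f i j) (I * w i) = a i * inner ℝ (w i) (I * w i) := by
        rw [show inner ℝ (w i) (I * w i) = inner ℝ (∑ j, a j • f i j) (I * w i) from rfl,
          sum_inner, Finset.mul_sum]
        refine Finset.sum_congr rfl fun j _ => ?_
        rw [real_inner_smul_left, mul_assoc]
      rw [e, inner_I_mul_self, mul_zero]
    have h3 : ∑ i, ∑ j, a i * a j * inner ℝ (f j i) (I * w j) = 0 := by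
      rw [Finset.sum_comm, ← h2]
      exact Finset.sum_congr rfl fun i _ => Finset.sum_congr rfl fun j _ => by ring
    refine h1.congr_deriv ?_
    have e : ∀ i j, a i * a j * (1 / 2 *
        (inner ℝ (f i j) (I * w i) + inner ℝ (f j i) (I * w j))) =
        1 / 2 * (a i * a j * inner ℝ (f i j) (I * w i)) +
        1 / 2 * (a i * a j * inner ℝ (f j i) (I * w j)) := fun i j => by ring
    simp only [e, Finset.sum_add_distrib, ← Finset.mul_sum, h2, h3]
    norm_num
  have h0 : (0 : ℝ) ∈ Set.Ico 0 T := ⟨le_rfl, ht.1.trans_lt ht.2⟩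
  have := (convex_Ico 0 T).norm_image_sub_le_of_norm_hasDerivWithin_le hderiv
    (C := 0) (fun t _ => by simp) h0 ht
  rw [zero_mul, norm_le_zero_iff, sub_eq_zero] at this
  exact this

/-- Conservation of energy separates the vortices if they stay away from the boundary. -/
lemma exists_separation (h : IsHeight s D) (ha : ∀ i, 0 < a i)
    (hx : IsFlowLine (phaseSpace N s) (vortexField s D a) (Set.Ico 0 T) x) {c : ℝ} (hc : 0 < c)
    (hcx : ∀ t ∈ Set.Ico 0 T, ∀ i, c ≤ s (x t i)) :
    ∃ d > 0, ∀ t ∈ Set.Ico 0 T, ∀ i j, i ≠ j → d ≤ ‖x t i - x t j‖ := by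
  set M : ℝ := ∑ i, a i * a i * (-(1 / (2 * Real.pi)) * Real.log c) - 2 * energy s a (x 0) with hM
  have hpair : ∀ t ∈ Set.Ico 0 T, ∀ i j, i ≠ j →
      a i * a j * -pairEnergy s (x t i) (x t j) ≤ M := by
    intro t ht p q hpq
    have hmem := hx.mem t ht
    -- `Q` is the negated pair energy with its diagonal removed, so all entries are nonnegative and
    -- each is at most the whole sum.
    set Q : Fin N → Fin N → ℝ := fun i j =>
      a i * a j * -pairEnergy s (x t i) (x t j) +
        if i = j then a i * a j * pairEnergy s (x t i) (x t j) else 0 with hQ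
    have hQ0 : ∀ i j, 0 ≤ Q i j := by
      intro i j
      rcases eq_or_ne i j with rfl | hij
      · simp [hQ]
      · have := pairEnergy_nonpos (hmem.1 i) (hmem.1 j) (hmem.2 i j hij)
        have := mul_pos (ha i) (ha j)
        simp only [hQ, hij, if_false, add_zero]
        exact mul_nonneg this.le (by linarith)
    have hle : Q p q ≤ ∑ i, ∑ j, Q i j :=
      (Finset.single_le_sum (fun j _ => hQ0 p j) (Finset.mem_univ q)).trans
        (Finset.single_le_sum (f := fun i => ∑ j, Q i j)
          (fun i _ => Finset.sum_nonneg fun j _ => hQ0 i j) (Finset.mem_univ p))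
    have hsum : ∑ i, ∑ j, Q i j =
        ∑ i, a i * a i * pairEnergy s (x t i) (x t i) - 2 * energy s a (x t) := by
      simp only [hQ, Finset.sum_add_distrib, Finset.sum_ite_eq, Finset.mem_univ, if_true, energy,
        Finset.mul_sum]
      rw [add_comm, sub_eq_add_neg, ← Finset.sum_neg_distrib]
      congr 1
      refine Finset.sum_congr rfl fun i _ => ?_
      rw [← Finset.sum_neg_distrib]
      exact Finset.sum_congr rfl fun j _ => by ring
    have hdiag : ∑ i, a i * a i * pairEnergy s (x t i) (x t i) ≤
        ∑ i, a i * a i * (-(1 / (2 * Real.pi)) * Real.log c) :=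
      Finset.sum_le_sum fun i _ => mul_le_mul_of_nonneg_left (pairEnergy_self_le hc (hcx t ht i))
        (mul_pos (ha i) (ha i)).le
    have hpq' : Q p q = a p * a q * -pairEnergy s (x t p) (x t q) := by simp [hQ, hpq]
    rw [hsum, h.energy_eq hx ht] at hle
    linarith
  have hone : ∀ i j, ∃ d > 0, ∀ t ∈ Set.Ico 0 T, i ≠ j → d ≤ ‖x t i - x t j‖ := by
    intro i j
    set R : ℝ := M / (a i * a j) * (4 * Real.pi) with hR
    -- From `log (imageDistSq) - 2 * log r ≤ R` and `imageDistSq ≥ c ^ 2` it follows that `log r ≥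
    -- log c - R / 2`.
    refine ⟨c * Real.exp (-R / 2), by positivity, fun t ht hij => ?_⟩
    have hmem := hx.mem t ht
    have haij := mul_pos (ha i) (ha j)
    have hr : 0 < ‖x t i - x t j‖ := norm_pos_iff.mpr (sub_ne_zero.mpr (hmem.2 i j hij))
    have h1 : -pairEnergy s (x t i) (x t j) ≤ M / (a i * a j) := by
      rw [le_div_iff₀ haij, mul_comm]
      exact hpair t ht i j hij
    have h2 : Real.log (imageDistSq s (x t i) (x t j)) - Real.log (‖x t i - x t j‖ ^ 2) ≤ R := by
      have e : Real.log (imageDistSq s (x t i) (x t j)) - Real.log (‖x t i - x t j‖ ^ 2) =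
          -pairEnergy s (x t i) (x t j) * (4 * Real.pi) := by
        unfold pairEnergy; field_simp; ring
      rw [e, hR]
      gcongr
    have h3 : c ^ 2 ≤ imageDistSq s (x t i) (x t j) := by
      have h4 : c * c ≤ s (x t i) * s (x t j) :=
        mul_le_mul (hcx t ht i) (hcx t ht j) hc.le (hmem.1 i).le
      unfold imageDistSq
      nlinarith [sq_nonneg ‖x t i - x t j‖]
    have h4 := Real.log_le_log (by positivity) h3
    rw [Real.log_pow] at h2 h4
    push_cast at h2 h4
    rw [← Real.log_le_log_iff (by positivity) hr, Real.log_mul hc.ne' (Real.exp_pos _).ne',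
      Real.log_exp]
    linarith
  choose d hd hdx using hone
  rcases isEmpty_or_nonempty (Fin N) with hN | hN
  · exact ⟨1, one_pos, fun t _ i => hN.elim i⟩
  · obtain ⟨k, hk⟩ := Finite.exists_min fun p : Fin N × Fin N => d p.1 p.2
    exact ⟨d k.1 k.2, hd _ _, fun t ht i j hij => (hk (i, j)).trans (hdx i j t ht hij)⟩

lemma norm_pairForce_le (h : IsHeight s D) {c d : ℝ} (hc : 0 < c) (hd : 0 < d) {z w : ℂ}
    (hz : c ≤ s z) (hw : 0 < s w) (hzw : z = w ∨ d ≤ ‖z - w‖) :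
    ‖pairForce s D z w‖ ≤ 1 / (4 * Real.pi) * (4 / d + 2 / c) := by
  have hz0 := hc.trans_le hz
  have hB := imageDistSq_pos hz0 hw
  have h1 : ‖(2 / ‖z - w‖ ^ 2) • (z - w)‖ ≤ 2 / d := by
    rcases hzw with rfl | hzw
    · simp only [sub_self, smul_zero, norm_zero]; positivity
    · have hr := hd.trans_le hzw
      rw [norm_smul, Real.norm_of_nonneg (by positivity)]
      calc 2 / ‖z - w‖ ^ 2 * ‖z - w‖ = 2 / ‖z - w‖ := by field_simp
        _ ≤ 2 / d := by gcongr
  have h2 : ‖(1 / imageDistSq s z w) • ((2 : ℝ) • (z - w))‖ ≤ 2 / d := by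
    rcases hzw with rfl | hzw
    · simp only [sub_self, smul_zero, norm_zero]; positivity
    · have hr := hd.trans_le hzw
      have hBr : ‖z - w‖ ^ 2 ≤ imageDistSq s z w := by
        have := mul_pos hz0 hw
        unfold imageDistSq; linarith
      rw [norm_smul, norm_smul, Real.norm_of_nonneg (by positivity), Real.norm_of_nonneg two_pos.le]
      calc 1 / imageDistSq s z w * (2 * ‖z - w‖) ≤ 1 / ‖z - w‖ ^ 2 * (2 * ‖z - w‖) := by gcongr
        _ = 2 / ‖z - w‖ := by field_simp
        _ ≤ 2 / d := by gcongr
  have h3 : ‖(1 / imageDistSq s z w) • (s w • D z)‖ ≤ 2 / c := by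
    have hBs : c * s w ≤ imageDistSq s z w := by
      have : c * s w ≤ s z * s w := by gcongr
      unfold imageDistSq; nlinarith [sq_nonneg ‖z - w‖]
    rw [norm_smul, norm_smul, Real.norm_of_nonneg (by positivity), Real.norm_of_nonneg hw.le]
    calc 1 / imageDistSq s z w * (s w * ‖D z‖) ≤ 1 / (c * s w) * (s w * 2) := by
          gcongr
          exact h.norm_grad_le z hz0.le
      _ = 2 / c := by field_simp
  rw [pairForce, norm_smul, Real.norm_of_nonneg (by positivity), smul_add]
  gcongr
  calc _ ≤ 2 / d + (2 / d + 2 / c) := (norm_sub_le _ _).trans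
        (add_le_add h1 ((norm_add_le _ _).trans (add_le_add h2 h3)))
    _ = 4 / d + 2 / c := by ring

theorem exists_confinement (h : IsHeight s D) (ha : ∀ i, 0 < a i) (hT : 0 < T)
    (hx : IsFlowLine (phaseSpace N s) (vortexField s D a) (Set.Ico 0 T) x) :
    ∃ c > 0, (∀ t ∈ Set.Ico 0 T, ∀ i, c ≤ s (x t i)) ∧
      ∀ t ∈ Set.Ico 0 T, ∀ i j, i ≠ j → c ≤ ‖x t i - x t j‖ := by
  obtain ⟨c, hc, hcx⟩ := (h.isHeightSystem ha hx).exists_lower_bound (by positivity) hT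
  obtain ⟨d, hd, hdx⟩ := h.exists_separation ha hx hc hcx
  exact ⟨min c d, lt_min hc hd, fun t ht i => (min_le_left _ _).trans (hcx t ht i),
    fun t ht i j hij => (min_le_right _ _).trans (hdx t ht i j hij)⟩

/-- The lower bounds on heights and distances define a closed set that may be unbounded, as in the
half-plane. They also bound the speed by some `V`, so over time `T` the trajectory stays in a ball
of radius `V * T`. -/
lemma exists_isCompact (h : IsHeight s D) (ha : ∀ i, 0 < a i) (hT : 0 < T)
    (hx : IsFlowLine (phaseSpace N s) (vortexField s D a) (Set.Ico 0 T) x) :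
    ∃ K ⊆ phaseSpace N s, IsCompact K ∧ ∀ t ∈ Set.Ico 0 T, x t ∈ K := by
  obtain ⟨c, hc, hcx, hdx⟩ := h.exists_confinement ha hT hx
  set V : ℝ := ∑ j, a j * (1 / (4 * Real.pi) * (4 / c + 2 / c)) with hV
  have hV0 : 0 ≤ V := Finset.sum_nonneg fun j _ => mul_nonneg (ha j).le (by positivity)
  have hbound : ∀ t ∈ Set.Ico 0 T, ‖vortexField s D a (x t)‖ ≤ V := by
    intro t ht
    refine (pi_norm_le_iff_of_nonneg hV0).mpr fun i => ?_
    rw [vortexField, norm_mul, norm_I, one_mul]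
    refine (norm_sum_le _ _).trans (Finset.sum_le_sum fun j _ => ?_)
    rw [norm_smul, Real.norm_of_nonneg (ha j).le]
    refine mul_le_mul_of_nonneg_left ?_ (ha j).le
    refine h.norm_pairForce_le hc hc (hcx t ht i) (hc.trans_le (hcx t ht j)) ?_
    rcases eq_or_ne i j with rfl | hij
    · exact Or.inl rfl
    · exact Or.inr (hdx t ht i j hij)
  set K : Set (Fin N → ℂ) := Metric.closedBall (x 0) (V * T) ∩
    ((⋂ i, {y | c ≤ s (y i)}) ∩ ⋂ i, ⋂ j, {y | i ≠ j → c ≤ ‖y i - y j‖}) with hK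
  have hs := h.contDiff.continuous
  have hclosed : IsClosed ((⋂ i, {y : Fin N → ℂ | c ≤ s (y i)}) ∩
      ⋂ i, ⋂ j, {y | i ≠ j → c ≤ ‖y i - y j‖}) := by
    refine (isClosed_iInter fun i => isClosed_le continuous_const (by fun_prop)).inter
      (isClosed_iInter fun i => isClosed_iInter fun j => ?_)
    by_cases hij : i = j
    · simp [hij]
    · simpa [hij] using isClosed_le continuous_const (by fun_prop)
  refine ⟨K, fun y hy => ⟨fun i => ?_, fun i j hij e => ?_⟩,
    (isCompact_closedBall _ _).inter_right hclosed, fun t ht => ⟨?_, ?_, ?_⟩⟩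
  · exact hc.trans_le (Set.mem_iInter.mp hy.2.1 i)
  · have : c ≤ ‖y i - y j‖ := Set.mem_iInter.mp (Set.mem_iInter.mp hy.2.2 i) j hij
    rw [e, sub_self, norm_zero] at this
    linarith
  · have := (convex_Ico 0 T).norm_image_sub_le_of_norm_hasDerivWithin_le hx.ode hbound
      ⟨le_rfl, hT⟩ ht
    rw [mem_closedBall_iff_norm]
    refine this.trans (mul_le_mul_of_nonneg_left ?_ hV0)
    rw [sub_zero, Real.norm_of_nonneg ht.1]
    exact ht.2.le
  · exact Set.mem_iInter.mpr fun i => hcx t ht i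
  · exact Set.mem_iInter.mpr fun i => Set.mem_iInter.mpr fun j => hdx t ht i j

end IsHeight
end Confinement

/-! ### The half-plane and the disk, and the conclusion -/

section Domains

variable {Ω : Set ℂ} {γ : ℂ → ℂ → ℝ} {s : ℂ → ℝ} {D : ℂ → ℂ}

/-- The height `s` describes the domain `Ω` and its Green's function. -/
structure IsHeightOf (Ω : Set ℂ) (γ : ℂ → ℂ → ℝ) (s : ℂ → ℝ) (D : ℂ → ℂ) : Prop
    extends IsHeight s D where
  mem_iff : ∀ x, x ∈ Ω ↔ 0 < s x
  green_eq : ∀ x y, greenFunction γ x y = pairEnergy s x y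
  robin_eq : ∀ x, robinFunction γ x = -(1 / (2 * Real.pi)) * Real.log (s x)

/-- The height in the half-plane is twice the distance to the boundary. -/
lemma isHeightOf_halfPlane :
    IsHeightOf halfPlane regularHalfPlane (fun x => 2 * x.im) (fun _ => 2 * I) where
  grad x := by
    rw [hasGradientAt_iff_hasFDerivAt]
    refine (Complex.imCLM.hasFDerivAt.const_mul (2 : ℝ)).congr_fderiv ?_
    ext v
    simp [InnerProductSpace.toDual_apply_apply]
    ring
  contDiff := contDiff_const.mul Complex.imCLM.contDiff
  contDiff_grad := contDiff_const
  inner_rotation x y := by simp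
  sub_le x y _ _ := by
    rw [← mul_sub, abs_mul, abs_two, ← Complex.sub_im]
    gcongr
    exact Complex.abs_im_le_norm _
  norm_grad_le x _ := by simp
  mem_iff x := by simp [halfPlane]
  green_eq x y := by
    -- This identity, like its analogue for the disk, holds on the whole plane, so the Green's
    -- functions agree as functions and can be exchanged under the gradient.
    have h : ‖x - conj y‖ ^ 2 = imageDistSq (fun x => 2 * x.im) x y := by
      simp only [imageDistSq, ← Complex.normSq_eq_norm_sq, Complex.normSq_apply]
      simp
      ring
    rw [pairEnergy, ← h, Real.log_pow, Real.log_pow, greenFunction, greenPlane, regularHalfPlane]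
    push_cast
    ring
  robin_eq x := by
    have h : ‖x - conj x‖ = |2 * x.im| := by
      rw [Complex.sub_conj]; simp
    rw [robinFunction, regularHalfPlane, h, Real.log_abs]

/-- The height in the disk is `1 - |x|²`. -/
lemma isHeightOf_unitDisk :
    IsHeightOf unitDisk regularDisk (fun x => 1 - ‖x‖ ^ 2) (fun x => (-2 : ℝ) • x) where
  grad x := by
    rw [hasGradientAt_iff_hasFDerivAt]
    refine ((hasFDerivAt_id x).norm_sq.const_sub 1).congr_fderiv ?_
    ext v
    simp [InnerProductSpace.toDual_apply_apply]
    ring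
  contDiff := contDiff_const.sub (contDiff_norm_sq ℝ)
  contDiff_grad := contDiff_id.const_smul (-2 : ℝ)
  inner_rotation x y := by
    rw [← smul_sub, real_inner_smul_left, inner_I_mul_self, mul_zero]
  sub_le x y hx hy := by
    have hx1 : ‖x‖ ≤ 1 := by nlinarith [norm_nonneg x]
    have hy1 : ‖y‖ ≤ 1 := by nlinarith [norm_nonneg y]
    have h1 := abs_norm_sub_norm_le x y
    have e : (1 - ‖x‖ ^ 2) - (1 - ‖y‖ ^ 2) = -((‖x‖ + ‖y‖) * (‖x‖ - ‖y‖)) := by ring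
    rw [e, abs_neg, abs_mul, abs_of_nonneg (by positivity)]
    exact mul_le_mul (by linarith) h1 (abs_nonneg _) two_pos.le
  norm_grad_le x hx := by
    have hx1 : ‖x‖ ≤ 1 := by nlinarith [norm_nonneg x]
    rw [norm_smul]
    norm_num
    linarith
  mem_iff x := by
    rw [unitDisk, mem_ball_zero_iff, sub_pos, sq_lt_one_iff₀ (norm_nonneg x)]
  green_eq x y := by
    have h : ‖1 - x * conj y‖ ^ 2 = imageDistSq (fun x => 1 - ‖x‖ ^ 2) x y := by
      simp only [imageDistSq, ← Complex.normSq_eq_norm_sq, Complex.normSq_apply]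
      simp
      ring
    rw [pairEnergy, ← h, Real.log_pow, Real.log_pow, greenFunction, greenPlane, regularDisk]
    push_cast
    ring
  robin_eq x := by
    have h : ‖1 - x * conj x‖ = |1 - ‖x‖ ^ 2| := by
      rw [Complex.mul_conj, Complex.normSq_eq_norm_sq, ← Complex.ofReal_one, ← Complex.ofReal_sub,
        Complex.norm_real, Real.norm_eq_abs]
    rw [robinFunction, regularDisk, h, Real.log_abs]

namespace IsHeightOf

variable {N : ℕ} {a : Fin N → ℝ}

/-- The Robin term is the diagonal term `j = i` of `totalForce`: `a i / 2` times the gradient of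
`-(2π)⁻¹ log s` is `a i` times the diagonal `pairForce`. -/
lemma velocity_eq (h : IsHeightOf Ω γ s D) {x : Fin N → ℂ} (hx : x ∈ phaseSpace N s) (i : Fin N) :
    velocity γ a x i = vortexField s D a x i := by
  have h1 : ∀ j ∈ Finset.univ.erase i,
      (a j : ℂ) * perpGrad (fun z => greenFunction γ z (x j)) (x i) =
        I * (a j • pairForce s D (x i) (x j)) := by
    intro j hj
    have hij : x i ≠ x j := hx.2 i j (Finset.ne_of_mem_erase hj).symm
    have e : (fun z => greenFunction γ z (x j)) = fun z => pairEnergy s z (x j) :=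
      funext fun z => h.green_eq z (x j)
    rw [e, perpGrad, (h.toIsHeight.hasGradientAt_pairEnergy (hx.1 i) (hx.1 j) hij).gradient,
      Complex.real_smul]
    ring
  have h2 : HasGradientAt (robinFunction γ) ((-(1 / (2 * Real.pi)) / s (x i)) • D (x i)) (x i) := by
    rw [funext h.robin_eq, hasGradientAt_iff_hasFDerivAt]
    refine (((h.grad (x i)).hasFDerivAt.log (hx.1 i).ne').const_mul _).congr_fderiv ?_
    rw [smul_smul, map_smul]
    rfl
  rw [velocity, Finset.sum_congr rfl h1, perpGrad, h2.gradient, vortexField, totalForce,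
    ← Finset.add_sum_erase _ _ (Finset.mem_univ i), mul_add, Finset.mul_sum, add_comm]
  congr 1
  rw [pairForce_self (hx.1 i)]
  simp only [Complex.real_smul]
  push_cast
  ring

lemma isSolutionOn_iff (h : IsHeightOf Ω γ s D) {x₀ : Fin N → ℂ} {S : Set ℝ}
    {x : ℝ → Fin N → ℂ} : IsSolutionOn Ω γ a x₀ S x ↔
      x 0 = x₀ ∧ IsFlowLine (phaseSpace N s) (vortexField s D a) S x := by
  constructor
  · intro hx
    have hmem : ∀ t ∈ S, x t ∈ phaseSpace N s := fun t ht =>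
      ⟨fun i => (h.mem_iff _).mp (hx.mem t ht i), hx.distinct t ht⟩
    refine ⟨hx.initial, hmem, fun t ht => hasDerivWithinAt_pi.mpr fun i => ?_⟩
    rw [← h.velocity_eq (hmem t ht)]
    exact hx.ode t ht i
  · rintro ⟨h0, hx⟩
    refine ⟨h0, fun t ht i => (h.mem_iff _).mpr ((hx.mem t ht).1 i), fun t ht => (hx.mem t ht).2,
      fun t ht i => ?_⟩
    rw [h.velocity_eq (hx.mem t ht)]
    exact hasDerivWithinAt_pi.mp (hx.ode t ht) i

/-- Since `s` vanishes on the boundary and `|s x - s z| ≤ 2 * ‖x - z‖`, a height of at least `c`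
forces a distance of at least `c / 2`. -/
lemma le_infEDist_frontier (h : IsHeightOf Ω γ s D) {c : ℝ} {x : ℂ} (hc : 0 < c) (hx : c ≤ s x) :
    ENNReal.ofReal (c / 2) ≤ Metric.infEDist x (frontier Ω) := by
  refine Metric.le_infEDist.mpr fun z hz => ?_
  have e : Ω = {x | 0 < s x} := Set.ext h.mem_iff
  have hz0 : 0 = s z := frontier_lt_subset_eq continuous_const h.contDiff.continuous (e ▸ hz)
  have h1 := h.sub_le x z (hc.le.trans hx) hz0.le
  rw [← hz0, sub_zero, abs_of_pos (hc.trans_le hx)] at h1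
  rw [edist_dist, dist_eq_norm]
  exact ENNReal.ofReal_le_ofReal (by linarith)

theorem global_existence_and_no_collapse (h : IsHeightOf Ω γ s D) (ha : ∀ i, 0 < a i)
    {x₀ : Fin N → ℂ} (hx₀ : ∀ i, x₀ i ∈ Ω) (hdist : ∀ i j, i ≠ j → x₀ i ≠ x₀ j) :
    (∃ x, IsSolutionOn Ω γ a x₀ (Set.Ici 0) x) ∧
    ∀ (T : ℝ) (x : ℝ → Fin N → ℂ), 0 < T → IsSolutionOn Ω γ a x₀ (Set.Ico 0 T) x →
      (∀ i j, i ≠ j → ¬ CollapseAt x T i j) ∧ ∀ i, ¬ BoundaryCollapseAt Ω x T i := by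
  refine ⟨?_, fun T x hT hx => ?_⟩
  · obtain ⟨x, hx⟩ := exists_isFlowLine_Ici (h.toIsHeight.isOpen_phaseSpace (N := N))
      (fun x hx => h.toIsHeight.contDiffAt_vortexField a hx)
      (x₀ := x₀) ⟨fun i => (h.mem_iff _).mp (hx₀ i), hdist⟩
      (fun T hT x _ hx => h.toIsHeight.exists_isCompact ha hT hx)
    exact ⟨x, h.isSolutionOn_iff.mpr hx⟩
  · obtain ⟨c, hc, hcx, hdx⟩ :=
      h.toIsHeight.exists_confinement ha hT (h.isSolutionOn_iff.mp hx).2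
    have hpos : ∀ (f : ℝ → ENNReal) (b : ℝ), 0 < b →
        (∀ t ∈ Set.Ico 0 T, ENNReal.ofReal b ≤ f t) → liminf f (𝓝[<] T) ≠ 0 := by
      intro f b hb hf
      refine ((ENNReal.ofReal_pos.mpr hb).trans_le (le_liminf_of_le ?_ ?_)).ne'
      · isBoundedDefault
      · filter_upwards [Ico_mem_nhdsLT hT] with t ht using hf t ht
    refine ⟨fun i j hij => hpos _ c hc fun t ht => ?_,
      fun i => hpos _ (c / 2) (half_pos hc) fun t ht => h.le_infEDist_frontier hc (hcx t ht i)⟩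
    rw [edist_dist, dist_eq_norm]
    exact ENNReal.ofReal_le_ofReal (hdx t ht i j hij)

end IsHeightOf
end Domains

end PointVortex

theorem theorem2p1 (Ω : Set ℂ) (γ : ℂ → ℂ → ℝ)
    (hΩ : (Ω = PointVortex.halfPlane ∧ γ = PointVortex.regularHalfPlane) ∨
      (Ω = PointVortex.unitDisk ∧ γ = PointVortex.regularDisk))
    (N : ℕ) (a : Fin N → ℝ) (ha : ∀ i, 0 < a i)
    (x₀ : Fin N → ℂ) (hx₀ : ∀ i, x₀ i ∈ Ω) (hdist : ∀ i j, i ≠ j → x₀ i ≠ x₀ j) :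
    (∃ x : ℝ → Fin N → ℂ, PointVortex.IsSolutionOn Ω γ a x₀ (Set.Ici 0) x) ∧
    (∀ (T : ℝ) (x : ℝ → Fin N → ℂ), 0 < T →
      PointVortex.IsSolutionOn Ω γ a x₀ (Set.Ico 0 T) x →
        (∀ i j, i ≠ j → ¬ PointVortex.CollapseAt x T i j) ∧
        (∀ i, ¬ PointVortex.BoundaryCollapseAt Ω x T i)) := by
  rcases hΩ with ⟨rfl, rfl⟩ | ⟨rfl, rfl⟩
  · exact PointVortex.isHeightOf_halfPlane.global_existence_and_no_collapse ha hx₀ hdist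
  · exact PointVortex.isHeightOf_unitDisk.global_existence_and_no_collapse ha hx₀ hdist
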